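/- Let $R$ be a left noetherian ring, $S$ a right noetherian ring, and let $C$ be a semi-dualizing $(R,S)$-bimodule: $C$ is finitely generated on both sides, the homothety maps $S\to\mathrm{Hom}_R(C,C)$ and $R\to\mathrm{Hom}_S(C,C)$ are bijective, and $\mathrm{Ext}^i_R(C,C)=0=\mathrm{Ext}^i_S(C,C)$ for all $i>0$. Let $\mathfrak D^b(R\text{-mod})$ (resp. $\mathfrak D^b(\text{mod-}S)$) be the derived category of complexes of left $R$-modules (resp. right $S$-modules) with bounded, finitely generated cohomology. For a complex $K^\bullet$ put $s(K^\bullet)=\sup\{n : H^n(K^\bullet)\ne 0\}$, $i(K^\bullet)=\inf\{n : H^n(K^\bullet)\neq 0\}$ and $a(K^\bullet)=s(K^\bullet)-i(K^\bullet)$. *$\mathrm G_C$-dimension of complexes.* For $M^\bullet\in\mathfrak D^b(R\text{-mod})$ put $\mathrm G_C\text{-}\dim_R M^\bullet=s(\mathbf R\mathrm{Hom}_R(M^\bullet,C))$ if $\mathbf R\mathrm{Hom}_R(M^\bullet,C)\in\mathfrak D^b(\text{mod-}S)$ and the natural morphism $M^\bullet\to\mathbf R\mathrm{Hom}_S(\mathbf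 R\mathrm{Hom}_R(M^\bullet,C),C)$ is an isomorphism, and $\mathrm G_C\text{-}\dim_R M^\bullet=+\infty$ otherwise. *$\mathrm G_C$-dimension of modules.* A finitely generated left $R$-module $X$ is $C$-reflexive if $\mathrm{Ext}^i_R(X,C)=0=\mathrm{Ext}^i_S(\mathrm{Hom}_R(X,C),C)$ for all $i>0$ and the natural map $X\to\mathrm{Hom}_S(\mathrm{Hom}_R(X,C),C)$ is bijective. For a finitely generated left $R$-module $T$, $\mathrm G_C\text{-}\dim_R T$ is the infimum of the $n\ge 0$ for which there is an exact sequence $0\to X^{-n}\to\cdots\to X^0\to T\to 0$ with all $X^j$ $C$-reflexive ($+\infty$ if there is none). *Trunk modules.* Let $M^\bullet\in\mathfrak D^b(R\text{-mod})$ with $H(M^\bullet)\neq0$. A standard projective resolution of $M^\bullet$ is a quasi-isomorphism $P^\bullet\to M^\bullet$ with all $P^n$ finitely generated projective and $P^n=0$ for $n>s(M^\bullet)$. Put $\omega P^\bullet=(\tau^{\le s-1}P^\bullet)[-1]$, where $s=s(P^\bullet)$ and $\tau^{\le s-1}$ is the brutal truncation, which replaces the terms in degrees $\geq s$ by $0$.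 A trunk module of $M^\bullet$ is a finitely generated module $T$ such that, for some standard projective resolution $P^\bullet$ of $M^\bullet$ and the least integer $b\ge0$ with $a(\omega^bP^\bullet)=0$, one has $\omega^bP^\bullet\cong T[-c]$ in $\mathfrak D^b(R\text{-mod})$ for some $c\in\mathbb Z$. **Theorem.** Let $M^\bullet\in\mathfrak D^b(R\text{-mod})$ with $H(M^\bullet)\ne0$, and let $T$ be a trunk module of $M^\bullet$. Then $$\mathrm G_C\text{-}\dim_R M^\bullet=\mathrm G_C\text{-}\dim_R T-i(M^\bullet),$$ where $\mathrm G_C\text{-}\dim_R T$ may be computed either as that of the module $T$ or as that of the complex consisting of $T$ in degree $0$. In particular $\mathrm G_C\text{-}\dim_R M^\bullet=+\infty$ if and only if $\mathrm G_C\text{-}\dim_R T=+\infty$. -/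

import Mathlib

open CategoryTheory

universe u

noncomputable section

namespace GCDim

/-! ### Supremum, infimum, amplitude and finiteness of cochain complexes -/

section Complexes

variable {A : Type u} [Ring A]

/-- `s(K) = sup {n | Hⁿ(K) ≠ 0}`, with `s(K) = -∞` for an acyclic complex. -/
def cohSup (K : CochainComplex (ModuleCat.{u} A) ℤ) : EReal :=
  ⨆ n ∈ {n : ℤ | ¬ K.ExactAt n}, ((n : ℝ) : EReal)

/-- `i(K) = inf {n | Hⁿ(K) ≠ 0}`, with `i(K) = +∞` for an acyclic complex. -/
def cohInf (K : CochainComplex (ModuleCat.{u} A) ℤ) : EReal :=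
  ⨅ n ∈ {n : ℤ | ¬ K.ExactAt n}, ((n : ℝ) : EReal)

/-- `a(K) = s(K) - i(K)`, with `a(K) = -∞` for an acyclic complex. -/
def amplitude (K : CochainComplex (ModuleCat.{u} A) ℤ) : EReal :=
  cohSup K - cohInf K

/-- `K` is an object of `𝔇ᵇ(A-mod)`: only finitely many cohomology modules are nonzero, and each of
them is finitely generated (the terms of `K` need not be). -/
structure IsBoundedFinite (K : CochainComplex (ModuleCat.{u} A) ℤ) : Prop where
  bounded : {n : ℤ | ¬ K.ExactAt n}.Finite
  finite (n : ℤ) : Module.Finite A (K.homology n)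

/-- The chain map `f : P ⟶ K` is a resolution of `K` by a bounded above complex of finitely
generated projective modules. -/
structure IsProjRes {P K : CochainComplex (ModuleCat.{u} A) ℤ} (f : P ⟶ K) : Prop where
  finite (n : ℤ) : Module.Finite A (P.X n)
  projective (n : ℤ) : Module.Projective A (P.X n)
  boundedAbove : ∃ N : ℤ, ∀ n : ℤ, N < n → Subsingleton (P.X n)
  quasiIso : QuasiIso f

/-- A resolution `P` of `K` by finitely generated projective modules is standard if
`Pⁿ = 0` for all `n > s(K)`. -/
structure IsStandardProjRes {P K : CochainComplex (ModuleCat.{u} A) ℤ} (f : P ⟶ K) : Prop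
    extends IsProjRes f where
  standard (n : ℤ) : cohSup K < ((n : ℝ) : EReal) → Subsingleton (P.X n)

/-- `ωP = (τ^{≤ s-1} P)[-1]`, where `τ^{≤ s-1}` is the brutal truncation and `s = s(P)`.
(It is only meaningful for `P` with bounded above nonzero cohomology, so that the integer
`sSup {n | Hⁿ(P) ≠ 0}` is a maximum and equals `s(P)`.) -/
def omegaOp (P : CochainComplex (ModuleCat.{u} A) ℤ) : CochainComplex (ModuleCat.{u} A) ℤ :=
  (HomologicalComplex.stupidTrunc P
    (ComplexShape.embeddingUpIntLE (sSup {n : ℤ | ¬ P.ExactAt n} - 1)))⟦(-1 : ℤ)⟧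

/-- `K ≅ T[-c]` in the derived category: `T[-c]` is the module `T` placed in degree `c`. -/
def IsoShiftedModule (K : CochainComplex (ModuleCat.{u} A) ℤ) (T : ModuleCat.{u} A) (c : ℤ) :
    Prop :=
  letI := HasDerivedCategory.standard (ModuleCat.{u} A)
  Nonempty (DerivedCategory.Q.obj K ≅ (DerivedCategory.singleFunctor (ModuleCat.{u} A) c).obj T)

/-- `T` is a trunk module of `K`: for some standard projective resolution `P` of `K` and for the
least `b` such that `ωᵇP` has amplitude `0`, one has `ωᵇP ≅ T[-c]` in the derived category
for some integer `c`. -/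
def IsTrunk (K : CochainComplex (ModuleCat.{u} A) ℤ) (T : ModuleCat.{u} A) : Prop :=
  Module.Finite A T ∧
    ∃ (P : CochainComplex (ModuleCat.{u} A) ℤ) (f : P ⟶ K) (b : ℕ) (c : ℤ),
      IsStandardProjRes f ∧ IsLeast {k : ℕ | amplitude (omegaOp^[k] P) = 0} b ∧
        IsoShiftedModule (omegaOp^[b] P) T c

end Complexes

/-! ### The functor `Hom_A(-, C)` on complexes, for a module `C` over two rings `A`, `B` with
commuting actions -/

section Duality

variable {A : Type u} [Ring A] (B : Type u) [Ring B]
  (C : Type u) [AddCommGroup C] [Module A C] [Module B C] [SMulCommClass A B C]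

/-- The `B`-linear map `Hom_A(N, C) → Hom_A(M, C)` given by composition with `f : M → N`. -/
def precomp {M N : ModuleCat.{u} A} (f : M ⟶ N) : (N →ₗ[A] C) →ₗ[B] (M →ₗ[A] C) where
  toFun g := g.comp f.hom
  map_add' _ _ := rfl
  map_smul' _ _ := rfl

/-- The complex of `B`-modules `Hom_A(K, C)`, with `Hom_A(K⁻ⁿ, C)` in degree `n`. -/
def dual (K : CochainComplex (ModuleCat.{u} A) ℤ) : CochainComplex (ModuleCat.{u} B) ℤ where
  X n := ModuleCat.of B (K.X (-n) →ₗ[A] C)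
  d i j := ModuleCat.ofHom (precomp B C (K.d (-j) (-i)))
  shape i j h := by
    have h' : ¬ (ComplexShape.up ℤ).Rel (-j) (-i) := by
      simp only [ComplexShape.up_Rel] at h ⊢
      omega
    ext g x
    simp [precomp, K.shape _ _ h']
  d_comp_d' i j k _ _ := by
    rw [← ModuleCat.ofHom_comp]
    have h : K.d (-k) (-j) ≫ K.d (-j) (-i) = 0 := K.d_comp_d _ _ _
    ext g x
    change g ((K.d (-k) (-j) ≫ K.d (-j) (-i)).hom x) = 0
    simp [h]

/-- The chain map `Hom_A(L, C) → Hom_A(K, C)` induced by `f : K ⟶ L`. -/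
def dualMap {K L : CochainComplex (ModuleCat.{u} A) ℤ} (f : K ⟶ L) :
    dual B C L ⟶ dual B C K where
  f n := ModuleCat.ofHom (precomp B C (f.f (-n)))
  comm' i j _ := by
    refine ModuleCat.hom_ext (LinearMap.ext fun (g : L.X (-i) →ₗ[A] C) => LinearMap.ext fun x => ?_)
    exact congrArg (fun h => g (h.hom x)) (f.comm (-j) (-i)).symm

variable [SMulCommClass B A C]

/-- The evaluation map `M → Hom_B(Hom_A(M, C), C)`, `x ↦ (g ↦ g x)`. -/
def evalMap (M : Type u) [AddCommGroup M] [Module A M] : M →ₗ[A] ((M →ₗ[A] C) →ₗ[B] C) where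
  toFun x :=
    { toFun := fun g => g x
      map_add' := fun _ _ => rfl
      map_smul' := fun _ _ => rfl }
  map_add' x y := by ext g; exact map_add g x y
  map_smul' a x := by ext g; exact map_smul g a x

/-- The natural chain map `K → Hom_B(Hom_A(K, C), C)`: in degree `n` it is the evaluation map of
`Kⁿ = K^{-(-n)}`. -/
def bidualMap (K : CochainComplex (ModuleCat.{u} A) ℤ) : K ⟶ dual A C (dual B C K) where
  f n := (K.XIsoOfEq (neg_neg n).symm).hom ≫
    ModuleCat.ofHom (evalMap B C (K.X (-(-n))))
  comm' i j _ := by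
    refine ModuleCat.hom_ext (LinearMap.ext fun x =>
      LinearMap.ext fun (g : K.X (-(-j)) →ₗ[A] C) => ?_)
    have h : (K.XIsoOfEq (neg_neg i).symm).hom ≫ K.d (-(-i)) (-(-j)) =
        K.d i j ≫ (K.XIsoOfEq (neg_neg j).symm).hom := by simp
    exact congrArg (fun f => g (f.hom x)) h

end Duality

/-! ### Semi-dualizing bimodules and `G_C`-dimension. Right `S`-modules are modules over `Sᵐᵒᵖ`. -/

section Bimodule

variable (R S : Type u) [Ring R] [Ring S] (C : Type u) [AddCommGroup C] [Module R C]
  [Module Sᵐᵒᵖ C] [SMulCommClass R Sᵐᵒᵖ C]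

/-- `C` is a semi-dualizing `(R, S)`-bimodule. -/
structure IsSemidualizing : Prop where
  finite_left : Module.Finite R C
  finite_right : Module.Finite Sᵐᵒᵖ C
  homothety_right : Function.Bijective fun s : S =>
    ({ toFun := fun c => MulOpposite.op s • c
       map_add' := fun c c' => smul_add _ c c'
       map_smul' := fun r c => (smul_comm r (MulOpposite.op s) c).symm } : C →ₗ[R] C)
  homothety_left : Function.Bijective fun r : R =>
    ({ toFun := fun c => r • c
       map_add' := fun c c' => smul_add _ c c'
       map_smul' := fun s c => smul_comm r s c } : C →ₗ[Sᵐᵒᵖ] C)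
  ext_left (i : ℕ) : 0 < i →
    Subsingleton (Abelian.Ext (ModuleCat.of R C) (ModuleCat.of R C) i)
  ext_right (i : ℕ) : 0 < i →
    Subsingleton (Abelian.Ext (ModuleCat.of Sᵐᵒᵖ C) (ModuleCat.of Sᵐᵒᵖ C) i)

/-- `M` is a `C`-reflexive (finitely generated) left `R`-module. -/
structure IsReflexive (M : ModuleCat.{u} R) : Prop where
  finite : Module.Finite R M
  ext_left (i : ℕ) : 0 < i → Subsingleton (Abelian.Ext M (ModuleCat.of R C) i)
  ext_right (i : ℕ) : 0 < i →
    Subsingleton (Abelian.Ext (ModuleCat.of Sᵐᵒᵖ (M →ₗ[R] C)) (ModuleCat.of Sᵐᵒᵖ C) i)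
  bijective :
    haveI := SMulCommClass.symm R Sᵐᵒᵖ C
    Function.Bijective (evalMap (A := R) Sᵐᵒᵖ C M)

/-- There is an exact sequence `0 → Xₙ → ⋯ → X₀ → M → 0` with `C`-reflexive modules `Xₖ`
(continued by `Xₖ = 0` for `k > n`). -/
def HasReflexiveResolution (M : ModuleCat.{u} R) (n : ℕ) : Prop :=
  ∃ (X : ℕ → ModuleCat.{u} R) (d : ∀ k, X (k + 1) →ₗ[R] X k) (ε : X 0 →ₗ[R] M),
    (∀ k ≤ n, IsReflexive R S C (X k)) ∧ (∀ k, n < k → Subsingleton (X k)) ∧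
    Function.Surjective ε ∧ Function.Exact (d 0) ε ∧ ∀ k, Function.Exact (d (k + 1)) (d k)

/-- The `G_C`-dimension of a module: the least length of a resolution by `C`-reflexive modules,
`+∞` if there is none. -/
def gcDimModule (M : ModuleCat.{u} R) : EReal :=
  ⨅ n ∈ {n : ℕ | HasReflexiveResolution R S C M n}, ((n : ℝ) : EReal)

/-- The class `ℛ_R(C)`, for objects `M` of `𝔇ᵇ(R-mod)`: with `P → M` a resolution by finitely
generated projectives, `RHom_R(M, C)` is `Hom_R(P, C)`; it has to lie in `𝔇ᵇ(mod-S)`; with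
`Q → Hom_R(P, C)` a resolution by finitely generated projective right `S`-modules, the natural
morphism `M → RHom_S(RHom_R(M, C), C)` is represented by the chain map
`P → Hom_S(Hom_R(P, C), C) → Hom_S(Q, C)`; it has to be a quasi-isomorphism. -/
def InClassR (M : CochainComplex (ModuleCat.{u} R) ℤ) : Prop :=
  haveI := SMulCommClass.symm R Sᵐᵒᵖ C
  ∃ (P : CochainComplex (ModuleCat.{u} R) ℤ) (f : P ⟶ M),
    IsProjRes f ∧ IsBoundedFinite (dual Sᵐᵒᵖ C P) ∧
    ∃ (Q : CochainComplex (ModuleCat.{u} Sᵐᵒᵖ) ℤ) (g : Q ⟶ dual Sᵐᵒᵖ C P),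
      IsProjRes g ∧ QuasiIso (bidualMap Sᵐᵒᵖ C P ≫ dualMap R C g)

/-- `s(RHom_R(M, C))`, the supremum of the `n` with `Hⁿ(RHom_R(M, C)) ≠ 0`; here `RHom_R(M, C)` is
`Hom_R(P, C)` for a resolution `P → M` by finitely generated projectives. -/
def supRHom (M : CochainComplex (ModuleCat.{u} R) ℤ) : EReal :=
  ⨆ n ∈ {n : ℤ | ∃ (P : CochainComplex (ModuleCat.{u} R) ℤ) (f : P ⟶ M),
    IsProjRes f ∧ ¬ (dual Sᵐᵒᵖ C P).ExactAt n}, ((n : ℝ) : EReal)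

open Classical in
/-- The `G_C`-dimension of an object of `𝔇ᵇ(R-mod)`: `s(RHom_R(M, C))` if `M` belongs to
`ℛ_R(C)`, and `+∞` otherwise. -/
def gcDim (M : CochainComplex (ModuleCat.{u} R) ℤ) : EReal :=
  if InClassR R S C M then supRHom R S C M else ⊤

end Bimodule

end GCDim

end

/-! Let `P → M` be a resolution by finitely generated projectives and let `i = i(M)`. As `P` is
exact below `i`, its part in degrees `≤ i` is a projective resolution of `Cok P i = coker(P^{i-1} →
P^i)`, with syzygies `Cok P (i - n)`. Every dimension in the theorem is read off from one number,
`syzDim (Cok P i)`: the least `n` for which some `n`-th syzygy is `C`-reflexive.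

For modules, the two-out-of-three properties of reflexive modules (`Refl.left`, `Refl.middle`,
`Refl.right`) and a Schanuel argument (`SyzRefl.of_stable_retract`) replace resolutions by
reflexives with projective ones having a reflexive last syzygy, so `gcDimModule = syzDim`.

For complexes the key is `isDerivedReflexive_iff`: if `P` is exact below `j`, then `Cok P j` is
reflexive if and only if `P` is derived reflexive and `Hom(P, C)` is exact above `-j`. The Ext
groups of `Cok P j` are cohomology groups of `Hom(P, C)`. For a resolution `Q → Hom(P, C)`,
biduality means that `Hom(-, C)` keeps the acyclic mapping cone exact, that is, that the cocycles of
the cone have vanishing Ext into `C`. Where `Q` is zero these cocycles are the duals of the modules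
`Cok P j`. This gives `gcDim M = syzDim (Cok P i) - i` in `gcDim_eq_syzDim_sub`.

As long as the amplitude is nonzero, `ω` raises the lowest cohomological degree by one and keeps the
cokernel there (`omegaOp_iterate`). After `b` steps the only cohomology is `T`, in degree `i + b`;
it embeds in that cokernel with quotient the image of a differential. This image is projective,
since the complex is exact beyond it and bounded above. Hence `T` and `Cok P i` have the same
`syzDim`, and the case of `T` as a complex is a second use of the formula. -/

noncomputable section

namespace GCDim

/-! ### Vanishing of Ext into `C` along short exact sequences -/

section ExtVanishing

variable (A : Type u) [Ring A] (C : Type u) [AddCommGroup C] [Module A C]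

/-- `Extⁱ_A(N, C) = 0`. -/
abbrev ExtZero (N : Type u) [AddCommGroup N] [Module A N] (i : ℕ) : Prop :=
  Subsingleton (Abelian.Ext (ModuleCat.of A N) (ModuleCat.of A C) i)

/-- `Extⁱ_A(N, C) = 0` for all `i > 0`. -/
def ExtVanish (N : Type u) [AddCommGroup N] [Module A N] : Prop :=
  ∀ i : ℕ, 0 < i → ExtZero A C N i

variable {A C}

lemma extVanish_of_projective (N : Type u) [AddCommGroup N] [Module A N] [Module.Projective A N] :
    ExtVanish A C N := by
  intro i hi
  obtain ⟨i, rfl⟩ := Nat.exists_eq_succ_of_ne_zero hi.ne'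
  have : Projective (ModuleCat.of A N) := (IsProjective.iff_projective _).1 inferInstance
  exact ⟨fun a b => (Abelian.Ext.eq_zero_of_projective a).trans
    (Abelian.Ext.eq_zero_of_projective b).symm⟩

variable {X Y Z : Type u} [AddCommGroup X] [Module A X] [AddCommGroup Y] [Module A Y]
  [AddCommGroup Z] [Module A Z]

lemma ExtVanish.of_retract (h : ExtVanish A C Y) (ι : X →ₗ[A] Y) (r : Y →ₗ[A] X)
    (hr : r ∘ₗ ι = LinearMap.id) : ExtVanish A C X := by
  intro i hi
  have := h i hi
  have key : ∀ a : Abelian.Ext (ModuleCat.of A X) (ModuleCat.of A C) i, a = 0 := by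
    intro a
    have h1 : (Abelian.Ext.mk₀ (ModuleCat.ofHom r)).comp a (zero_add i) = 0 :=
      Subsingleton.elim _ _
    have h2 : (Abelian.Ext.mk₀ (ModuleCat.ofHom ι)).comp
        ((Abelian.Ext.mk₀ (ModuleCat.ofHom r)).comp a (zero_add i)) (zero_add i) = a := by
      rw [Abelian.Ext.mk₀_comp_mk₀_assoc, ← ModuleCat.ofHom_comp, hr]
      exact Abelian.Ext.mk₀_id_comp a
    rw [← h2, h1, Abelian.Ext.comp_zero]
  exact ⟨fun a b => (key a).trans (key b).symm⟩

/-- The short exact sequence of modules given by linear maps. -/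
abbrev shortComplexOfExact (f : X →ₗ[A] Y) (g : Y →ₗ[A] Z) (hfg : Function.Exact f g) :
    ShortComplex (ModuleCat.{u} A) :=
  ModuleCat.shortComplexOfCompEqZero f g hfg.linearMap_comp_eq_zero

variable {f : X →ₗ[A] Y} {g : Y →ₗ[A] Z}

lemma shortExact_of_exact (hf : Function.Injective f) (hg : Function.Surjective g)
    (hfg : Function.Exact f g) : (shortComplexOfExact f g hfg).ShortExact :=
  ModuleCat.shortComplex_shortExact _ hfg hf hg

lemma extZero_middle (hf : Function.Injective f) (hg : Function.Surjective g)
    (hfg : Function.Exact f g) {i : ℕ} (hX : ExtZero A C X i) (hZ : ExtZero A C Z i) :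
    ExtZero A C Y i := by
  have hS := shortExact_of_exact hf hg hfg
  have key : ∀ a : Abelian.Ext (ModuleCat.of A Y) (ModuleCat.of A C) i, a = 0 := by
    intro a
    obtain ⟨b, hb⟩ := Abelian.Ext.contravariant_sequence_exact₂ hS (ModuleCat.of A C) a
      (Subsingleton.elim (α := Abelian.Ext (ModuleCat.of A X) (ModuleCat.of A C) i) _ _)
    rw [← hb, Subsingleton.elim (α := Abelian.Ext (ModuleCat.of A Z) (ModuleCat.of A C) i) b 0,
      Abelian.Ext.comp_zero]
  exact ⟨fun a b => (key a).trans (key b).symm⟩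

lemma ExtVanish.middle (hf : Function.Injective f) (hg : Function.Surjective g)
    (hfg : Function.Exact f g) (hX : ExtVanish A C X) (hZ : ExtVanish A C Z) :
    ExtVanish A C Y :=
  fun i hi => extZero_middle hf hg hfg (hX i hi) (hZ i hi)

lemma extZero_left_of_right (hf : Function.Injective f) (hg : Function.Surjective g)
    (hfg : Function.Exact f g) {i : ℕ} (hY : ExtZero A C Y i) (hZ : ExtZero A C Z (i + 1)) :
    ExtZero A C X i := by
  have hS := shortExact_of_exact hf hg hfg
  have key : ∀ a : Abelian.Ext (ModuleCat.of A X) (ModuleCat.of A C) i, a = 0 := by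
    intro a
    obtain ⟨b, hb⟩ := Abelian.Ext.contravariant_sequence_exact₁ hS (ModuleCat.of A C) a
      (add_comm 1 i)
      (Subsingleton.elim (α := Abelian.Ext (ModuleCat.of A Z) (ModuleCat.of A C) (i + 1)) _ _)
    rw [← hb, Subsingleton.elim (α := Abelian.Ext (ModuleCat.of A Y) (ModuleCat.of A C) i) b 0,
      Abelian.Ext.comp_zero]
  exact ⟨fun a b => (key a).trans (key b).symm⟩

lemma extZero_right_of_left (hf : Function.Injective f) (hg : Function.Surjective g)
    (hfg : Function.Exact f g) {i : ℕ} (hY : ExtZero A C Y (i + 1)) (hX : ExtZero A C X i) :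
    ExtZero A C Z (i + 1) := by
  have hS := shortExact_of_exact hf hg hfg
  have key : ∀ a : Abelian.Ext (ModuleCat.of A Z) (ModuleCat.of A C) (i + 1), a = 0 := by
    intro a
    obtain ⟨b, hb⟩ := Abelian.Ext.contravariant_sequence_exact₃ hS (ModuleCat.of A C) a
      (Subsingleton.elim (α := Abelian.Ext (ModuleCat.of A Y) (ModuleCat.of A C) (i + 1)) _ _)
      (add_comm 1 i)
    rw [← hb, Subsingleton.elim (α := Abelian.Ext (ModuleCat.of A X) (ModuleCat.of A C) i) b 0,
      Abelian.Ext.comp_zero]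
  exact ⟨fun a b => (key a).trans (key b).symm⟩

/-- The connecting map `Hom(X, C) → Ext¹(Z, C)` is onto because `Ext¹(Y, C) = 0`, and it kills every
map that extends to `Y`. -/
lemma extZero_one_of_extends (hf : Function.Injective f) (hg : Function.Surjective g)
    (hfg : Function.Exact f g) (hY : ExtZero A C Y 1)
    (h : ∀ φ : X →ₗ[A] C, ∃ ψ : Y →ₗ[A] C, ψ ∘ₗ f = φ) : ExtZero A C Z 1 := by
  have hS := shortExact_of_exact hf hg hfg
  have key : ∀ a : Abelian.Ext (ModuleCat.of A Z) (ModuleCat.of A C) 1, a = 0 := by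
    intro a
    obtain ⟨b, hb⟩ := Abelian.Ext.contravariant_sequence_exact₃ hS (ModuleCat.of A C) a
      (Subsingleton.elim (α := Abelian.Ext (ModuleCat.of A Y) (ModuleCat.of A C) 1) _ _)
      (add_zero 1)
    obtain ⟨φ, rfl⟩ := Abelian.Ext.addEquiv₀.symm.surjective b
    obtain ⟨ψ, hψ⟩ := h φ.hom
    have : φ = ModuleCat.ofHom f ≫ ModuleCat.ofHom ψ := by
      rw [← ModuleCat.ofHom_comp, hψ]; rfl
    rw [← hb, this]
    change hS.extClass.comp (Abelian.Ext.mk₀ _) _ = 0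
    rw [← Abelian.Ext.mk₀_comp_mk₀]
    exact hS.extClass_comp_assoc _
  exact ⟨fun a b => (key a).trans (key b).symm⟩

lemma exists_extension_of_extZero_one (hf : Function.Injective f) (hg : Function.Surjective g)
    (hfg : Function.Exact f g) (hZ : ExtZero A C Z 1) (φ : X →ₗ[A] C) :
    ∃ ψ : Y →ₗ[A] C, ψ ∘ₗ f = φ := by
  have hS := shortExact_of_exact hf hg hfg
  obtain ⟨b, hb⟩ := Abelian.Ext.contravariant_sequence_exact₁ hS (ModuleCat.of A C)
    (Abelian.Ext.mk₀ (ModuleCat.ofHom φ)) (add_zero 1)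
    (Subsingleton.elim (α := Abelian.Ext (ModuleCat.of A Z) (ModuleCat.of A C) 1) _ _)
  obtain ⟨ψ, rfl⟩ := Abelian.Ext.addEquiv₀.symm.surjective b
  refine ⟨ψ.hom, ?_⟩
  change (Abelian.Ext.mk₀ _).comp (Abelian.Ext.mk₀ _) _ = _ at hb
  rw [Abelian.Ext.mk₀_comp_mk₀] at hb
  have := (Abelian.Ext.mk₀_bijective _ _).injective hb
  exact congrArg ModuleCat.Hom.hom this

lemma ExtVanish.left (hf : Function.Injective f) (hg : Function.Surjective g)
    (hfg : Function.Exact f g) (hY : ExtVanish A C Y) (hZ : ExtVanish A C Z) :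
    ExtVanish A C X :=
  fun i hi => extZero_left_of_right hf hg hfg (hY i hi) (hZ (i + 1) (by omega))

/-- Dimension shifting reaches only degrees `≥ 2`; degree `1` is what the extension hypothesis is
for. -/
lemma ExtVanish.right (hf : Function.Injective f) (hg : Function.Surjective g)
    (hfg : Function.Exact f g) (hX : ExtVanish A C X) (hY : ExtVanish A C Y)
    (h : ∀ φ : X →ₗ[A] C, ∃ ψ : Y →ₗ[A] C, ψ ∘ₗ f = φ) : ExtVanish A C Z := by
  intro i hi
  obtain _ | _ | i := i
  · omega
  · exact extZero_one_of_extends hf hg hfg (hY 1 (by omega)) h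
  · exact extZero_right_of_left hf hg hfg (hY _ (by omega)) (hX _ (by omega))

end ExtVanishing

lemma exists_factorization {A : Type*} [Ring A] {X Y Z : Type*} [AddCommGroup X] [Module A X]
    [AddCommGroup Y] [Module A Y] [AddCommGroup Z] [Module A Z] (p : X →ₗ[A] Y)
    (hp : Function.Surjective p) (φ : X →ₗ[A] Z) (h : ∀ x, p x = 0 → φ x = 0) :
    ∃ ψ : Y →ₗ[A] Z, ψ ∘ₗ p = φ := by
  refine ⟨(LinearMap.ker p).liftQ φ (fun x hx => h x hx) ∘ₗ
    (p.quotKerEquivOfSurjective hp).symm.toLinearMap, ?_⟩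
  ext x
  have : (p.quotKerEquivOfSurjective hp).symm (p x) = (LinearMap.ker p).mkQ x := by
    rw [LinearEquiv.symm_apply_eq]; rfl
  simp only [LinearMap.comp_apply, LinearEquiv.coe_coe, this]
  exact Submodule.liftQ_apply _ _ _

/-! ### Reflexive modules: retracts, two out of three, projectives -/

section Reflexive

variable (A B C : Type u) [Ring A] [Ring B] [AddCommGroup C] [Module A C] [Module B C]
  [SMulCommClass A B C]

/-- The `B`-linear map `Hom_A(N, C) → Hom_A(M, C)` given by composition with `f : M → N`. -/
def dualLin {M N : Type u} [AddCommGroup M] [Module A M] [AddCommGroup N] [Module A N]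
    (f : M →ₗ[A] N) : (N →ₗ[A] C) →ₗ[B] (M →ₗ[A] C) where
  toFun g := g.comp f
  map_add' _ _ := rfl
  map_smul' _ _ := rfl

@[simp]
lemma dualLin_apply {M N : Type u} [AddCommGroup M] [Module A M] [AddCommGroup N] [Module A N]
    (f : M →ₗ[A] N) (g : N →ₗ[A] C) : dualLin A B C f g = g ∘ₗ f := rfl

section DualLin

variable {A B C} {X Y Z : Type u} [AddCommGroup X] [Module A X] [AddCommGroup Y] [Module A Y]
  [AddCommGroup Z] [Module A Z] {f : X →ₗ[A] Y} {g : Y →ₗ[A] Z} (hf : Function.Injective f)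
  (hg : Function.Surjective g) (hfg : Function.Exact f g)

include hg in
lemma dualLin_injective : Function.Injective (dualLin A B C g) := by
  intro φ ψ h
  ext z
  obtain ⟨y, rfl⟩ := hg z
  exact LinearMap.congr_fun h y

include hg hfg in
lemma dualLin_exact : Function.Exact (dualLin A B C g) (dualLin A B C f) := by
  intro φ
  constructor
  · intro h
    obtain ⟨ψ, hψ⟩ := exists_factorization g hg φ (fun y hy => by
      obtain ⟨x, rfl⟩ := (hfg y).1 hy
      exact LinearMap.congr_fun h x)
    exact ⟨ψ, hψ⟩
  · rintro ⟨ψ, rfl⟩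
    ext x
    simp [hfg.apply_apply_eq_zero]

include hf hg hfg in
lemma dualLin_surjective (hZ : ExtVanish A C Z) : Function.Surjective (dualLin A B C f) :=
  fun φ => exists_extension_of_extZero_one hf hg hfg (hZ 1 one_pos) φ

/-- Evaluation at `n` generators of `M` embeds the dual in `Cⁿ`, a noetherian module. -/
lemma finite_dual [IsNoetherianRing B] [Module.Finite B C] (M : Type u) [AddCommGroup M]
    [Module A M] [Module.Finite A M] : Module.Finite B (M →ₗ[A] C) := by
  obtain ⟨n, p, hp⟩ := Module.Finite.exists_fin' A M
  let e : (M →ₗ[A] C) →ₗ[B] (Fin n → C) :=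
    { toFun := fun φ i => φ (p (Pi.single i 1))
      map_add' := fun _ _ => rfl
      map_smul' := fun _ _ => rfl }
  refine Module.Finite.of_injective e fun φ ψ h => ?_
  ext x
  obtain ⟨v, rfl⟩ := hp x
  have : φ ∘ₗ p = ψ ∘ₗ p := LinearMap.pi_ext' fun i => LinearMap.ext_ring (congr_fun h i)
  exact LinearMap.congr_fun this v

end DualLin

variable [SMulCommClass B A C]

/-- Unbundled version of `C`-reflexivity for modules over a ring `A`, where `C` is a module over
two rings `A` and `B` with commuting actions. -/
structure Refl (M : Type u) [AddCommGroup M] [Module A M] : Prop where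
  finite : Module.Finite A M
  ext_left : ExtVanish A C M
  ext_right : ExtVanish B C (M →ₗ[A] C)
  bijective : Function.Bijective (evalMap (A := A) B C M)

variable {A B C}

@[simp]
lemma evalMap_apply {M : Type u} [AddCommGroup M] [Module A M] (x : M) (g : M →ₗ[A] C) :
    evalMap B C M x g = g x := rfl

variable {X Y Z : Type u} [AddCommGroup X] [Module A X] [AddCommGroup Y] [Module A Y]
  [AddCommGroup Z] [Module A Z]

lemma Refl.of_retract (h : Refl A B C Y) (ι : X →ₗ[A] Y) (r : Y →ₗ[A] X)
    (hr : r ∘ₗ ι = LinearMap.id) : Refl A B C X := by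
  have hr' : ∀ x, r (ι x) = x := fun x => LinearMap.congr_fun hr x
  have := h.finite
  refine ⟨Module.Finite.of_surjective r fun x => ⟨ι x, hr' x⟩, h.ext_left.of_retract ι r hr,
    h.ext_right.of_retract (dualLin A B C r) (dualLin A B C ι) ?_, ?_, ?_⟩
  · ext φ x
    simp [hr']
  · rw [injective_iff_map_eq_zero]
    intro x hx
    have : evalMap (A := A) B C Y (ι x) = 0 := by
      ext φ
      exact LinearMap.congr_fun hx (φ ∘ₗ ι)
    have := (injective_iff_map_eq_zero _).1 h.bijective.1 _ this
    rw [← hr' x, this, map_zero]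
  · intro ξ
    obtain ⟨y, hy⟩ := h.bijective.2 (ξ ∘ₗ dualLin A B C ι)
    refine ⟨r y, ?_⟩
    ext φ
    have := LinearMap.congr_fun hy (φ ∘ₗ r)
    simpa [LinearMap.comp_assoc, hr] using this

lemma Refl.of_equiv (h : Refl A B C Y) (e : X ≃ₗ[A] Y) : Refl A B C X :=
  h.of_retract e.toLinearMap e.symm.toLinearMap (by ext; simp)

section ShortExact

variable {f : X →ₗ[A] Y} {g : Y →ₗ[A] Z} (hf : Function.Injective f) (hg : Function.Surjective g)
    (hfg : Function.Exact f g)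

-- Since `Ext¹(Z, C) = 0`, the dual sequence `0 → Z* → Y* → X* → 0` is exact, and bijectivity of the
-- evaluation map is a diagram chase. `X` need not inherit finite generation from `Y`, so it is
-- assumed.
include hf hg hfg in
lemma Refl.left (hX : Module.Finite A X) (hY : Refl A B C Y) (hZ : Refl A B C Z) :
    Refl A B C X := by
  have hs := dualLin_surjective (B := B) hf hg hfg hZ.ext_left
  have he := dualLin_exact (B := B) (C := C) hg hfg
  refine ⟨hX, ExtVanish.left hf hg hfg hY.ext_left hZ.ext_left,
    ExtVanish.right (dualLin_injective hg) hs he hZ.ext_right hY.ext_right ?_, ?_, ?_⟩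
  -- A functional on `Z*` is evaluation at some `z`; evaluation at a lift of `z` to `Y` extends it
  -- to `Y*`.
  · intro ζ
    obtain ⟨z, rfl⟩ := hZ.bijective.2 ζ
    obtain ⟨y, rfl⟩ := hg z
    exact ⟨evalMap B C Y y, rfl⟩
  · rw [injective_iff_map_eq_zero]
    intro x hx
    apply hf
    rw [map_zero]
    apply (injective_iff_map_eq_zero _).1 hY.bijective.1
    ext φ
    exact LinearMap.congr_fun hx (φ ∘ₗ f)
  · intro ξ
    obtain ⟨y, hy⟩ := hY.bijective.2 (ξ ∘ₗ dualLin A B C f)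
    have hy' : ∀ φ : Y →ₗ[A] C, φ y = ξ (φ ∘ₗ f) := fun φ => LinearMap.congr_fun hy φ
    have : g y = 0 := by
      apply (injective_iff_map_eq_zero _).1 hZ.bijective.1
      ext φ
      have := hy' (φ ∘ₗ g)
      rw [LinearMap.comp_assoc, hfg.linearMap_comp_eq_zero, LinearMap.comp_zero, map_zero] at this
      exact this
    obtain ⟨x, rfl⟩ := (hfg y).1 this
    refine ⟨x, ?_⟩
    ext φ
    obtain ⟨ψ, rfl⟩ := hs φ
    exact hy' ψ

include hf hg hfg in
lemma Refl.middle (hX : Refl A B C X) (hZ : Refl A B C Z) : Refl A B C Y := by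
  have hs := dualLin_surjective (B := B) hf hg hfg hZ.ext_left
  have he := dualLin_exact (B := B) (C := C) hg hfg
  refine ⟨?_, ExtVanish.middle hf hg hfg hX.ext_left hZ.ext_left,
    ExtVanish.middle (dualLin_injective hg) hs he hZ.ext_right hX.ext_right, ?_, ?_⟩
  · have := hX.finite
    have := hZ.finite
    have h1 : (LinearMap.ker g).FG := by
      rw [hfg.linearMap_ker_eq]
      exact (Submodule.fg_top _).1 (Module.Finite.range f).1
    refine ⟨Submodule.fg_of_fg_map_of_fg_inf_ker g ?_ (by simpa using h1)⟩
    rw [Submodule.map_top, LinearMap.range_eq_top.2 hg]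
    exact hZ.finite.1
  · rw [injective_iff_map_eq_zero]
    intro y hy
    have hy' : ∀ φ : Y →ₗ[A] C, φ y = 0 := fun φ => LinearMap.congr_fun hy φ
    have : g y = 0 := by
      apply (injective_iff_map_eq_zero _).1 hZ.bijective.1
      ext φ
      exact hy' (φ ∘ₗ g)
    obtain ⟨x, rfl⟩ := (hfg y).1 this
    have : x = 0 := by
      apply (injective_iff_map_eq_zero _).1 hX.bijective.1
      ext φ
      obtain ⟨ψ, rfl⟩ := hs φ
      exact hy' ψ
    rw [this, map_zero]
  · intro η
    obtain ⟨z, hz⟩ := hZ.bijective.2 (η ∘ₗ dualLin A B C g)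
    obtain ⟨y, rfl⟩ := hg z
    obtain ⟨ξ, hξ⟩ := exists_factorization (dualLin A B C f) hs (η - evalMap B C Y y) (by
      intro φ hφ
      obtain ⟨ψ, rfl⟩ := (he φ).1 hφ
      have := LinearMap.congr_fun hz ψ
      simp only [evalMap_apply, LinearMap.comp_apply, dualLin_apply] at this
      simp [← this])
    obtain ⟨x, rfl⟩ := hX.bijective.2 ξ
    refine ⟨y + f x, ?_⟩
    ext φ
    have := LinearMap.congr_fun hξ φ
    simp only [LinearMap.comp_apply, dualLin_apply, evalMap_apply, LinearMap.sub_apply] at this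
    simp [this]

-- Over `A`, `Ext¹(Z, C)` does not vanish automatically, so it is assumed. Surjectivity of
-- evaluation uses `Ext¹(X*, C) = 0` to extend a functional from `Z*` to `Y*`, where it is
-- evaluation at an element of `Y`.
include hf hg hfg in
lemma Refl.right (hX : Refl A B C X) (hY : Refl A B C Y) (hZ : ExtVanish A C Z) :
    Refl A B C Z := by
  have hs := dualLin_surjective (B := B) hf hg hfg hZ
  have he := dualLin_exact (B := B) (C := C) hg hfg
  have := hY.finite
  refine ⟨Module.Finite.of_surjective g hg, hZ,
    ExtVanish.left (dualLin_injective hg) hs he hY.ext_right hX.ext_right, ?_, ?_⟩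
  · rw [injective_iff_map_eq_zero]
    intro z hz
    obtain ⟨y, rfl⟩ := hg z
    obtain ⟨ξ, hξ⟩ := exists_factorization (dualLin A B C f) hs (evalMap B C Y y) (by
      intro φ hφ
      obtain ⟨ψ, rfl⟩ := (he φ).1 hφ
      exact LinearMap.congr_fun hz ψ)
    obtain ⟨x, rfl⟩ := hX.bijective.2 ξ
    have : f x = y := hY.bijective.1 hξ
    rw [← this, hfg.apply_apply_eq_zero]
  · intro ζ
    obtain ⟨η, hη⟩ := exists_extension_of_extZero_one (dualLin_injective hg) hs he
      (hX.ext_right 1 one_pos) ζ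
    obtain ⟨y, rfl⟩ := hY.bijective.2 η
    exact ⟨g y, hη⟩

end ShortExact

lemma Refl.prod (hX : Refl A B C X) (hY : Refl A B C Y) : Refl A B C (X × Y) :=
  Refl.middle (f := LinearMap.inl A X Y) (g := LinearMap.snd A X Y) LinearMap.inl_injective
    LinearMap.snd_surjective .inl_snd hX hY

lemma refl_of_subsingleton [Subsingleton X] : Refl A B C X := by
  have : Subsingleton (X →ₗ[A] C) := ⟨fun a b => by ext x; rw [Subsingleton.elim x 0]; simp⟩
  exact ⟨inferInstance, extVanish_of_projective _, extVanish_of_projective _,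
    fun _ _ _ => Subsingleton.elim _ _, fun ξ => ⟨0, by
      ext φ; rw [Subsingleton.elim φ 0]; simp⟩⟩

lemma Refl.of_projective (hA : Refl A B C A) (M : Type u) [AddCommGroup M] [Module A M]
    [Module.Finite A M] [Module.Projective A M] : Refl A B C M := by
  have hfree : ∀ n : ℕ, Refl A B C (Fin n → A) := by
    intro n
    induction n with
    | zero => exact refl_of_subsingleton
    | succ n ih =>
      refine Refl.middle (f := LinearMap.single A (fun _ : Fin (n + 1) => A) 0)
        (g := LinearMap.funLeft A A Fin.succ) (Pi.single_injective (M := fun _ : Fin (n + 1) => A) 0)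
        (LinearMap.funLeft_surjective_of_injective _ _ _ (Fin.succ_injective n)) ?_ hA ih
      intro v
      constructor
      · intro hv
        refine ⟨v 0, ?_⟩
        ext i
        refine Fin.cases ?_ (fun j => ?_) i
        · simp
        · simpa using (congr_fun hv j).symm
      · rintro ⟨a, rfl⟩
        ext i
        simp [LinearMap.funLeft]
  obtain ⟨n, p, hp⟩ := Module.Finite.exists_fin' A M
  obtain ⟨s, hs⟩ := Module.projective_lifting_property p LinearMap.id hp
  exact (hfree n).of_retract s p hs

end Reflexive

section

variable {R S : Type u} [Ring R] [Ring S] {C : Type u} [AddCommGroup C] [Module R C]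
  [Module Sᵐᵒᵖ C] [SMulCommClass R Sᵐᵒᵖ C] [SMulCommClass Sᵐᵒᵖ R C]

lemma isReflexive_iff (M : ModuleCat.{u} R) : IsReflexive R S C M ↔ Refl R Sᵐᵒᵖ C M :=
  ⟨fun h => ⟨h.1, h.2, h.3, h.4⟩, fun h => ⟨h.1, h.2, h.3, h.4⟩⟩

/-- Under `Hom_R(R, C) ≅ C`, evaluation on `R` becomes the homothety `R → Hom_S(C, C)`, and the
condition on the dual becomes the vanishing of `Ext_S(C, C)`. -/
lemma IsSemidualizing.refl_self (h : IsSemidualizing R S C) : Refl R Sᵐᵒᵖ C R := by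
  refine ⟨inferInstance, extVanish_of_projective _, ?_, ?_, ?_⟩
  · let e : (R →ₗ[R] C) →ₗ[Sᵐᵒᵖ] C :=
      { toFun := fun φ => φ 1, map_add' := fun _ _ => rfl, map_smul' := fun _ _ => rfl }
    let e' : C →ₗ[Sᵐᵒᵖ] (R →ₗ[R] C) :=
      { toFun := fun c => LinearMap.toSpanSingleton R C c
        map_add' := fun _ _ => by ext; simp
        map_smul' := fun _ _ => by ext; simp }
    exact ExtVanish.of_retract (Y := C) h.ext_right e e' (by ext; simp [e, e'])
  · intro r r' hr
    apply h.homothety_left.1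
    ext c
    simpa using LinearMap.congr_fun hr (LinearMap.toSpanSingleton R C c)
  · intro ξ
    let e' : C →ₗ[Sᵐᵒᵖ] (R →ₗ[R] C) :=
      { toFun := fun c => LinearMap.toSpanSingleton R C c
        map_add' := fun _ _ => by ext; simp
        map_smul' := fun _ _ => by ext; simp }
    obtain ⟨r, hr⟩ := h.homothety_left.2 (ξ ∘ₗ e')
    refine ⟨r, ?_⟩
    ext φ
    have h1 := LinearMap.congr_fun hr (φ 1)
    have h2 : e' (φ 1) = φ := by ext; simp [e']
    simp only [LinearMap.comp_apply, h2] at h1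
    rw [← h1, evalMap_apply]
    change φ r = r • φ 1
    rw [← map_smul, smul_eq_mul, mul_one]

end

/-! ### Reflexive syzygies and Schanuel's lemma -/

section Syzygies

variable (A B C : Type u) [Ring A] [Ring B] [AddCommGroup C] [Module A C] [Module B C]
  [SMulCommClass A B C] [SMulCommClass B A C]

/-- Some `n`-th syzygy of `Z`, computed with finitely generated projectives, is `C`-reflexive. -/
def SyzRefl : ℕ → ∀ (Z : Type u) [AddCommGroup Z] [Module A Z], Prop
  | 0, Z, _, _ => Refl A B C Z
  | n + 1, Z, _, _ => ∃ (F : Type u) (_ : AddCommGroup F) (_ : Module A F) (π : F →ₗ[A] Z),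
      Module.Finite A F ∧ Module.Projective A F ∧ Function.Surjective π ∧
        SyzRefl n (LinearMap.ker π)

variable {A B C} (hA : Refl A B C A)

lemma SyzRefl.finite {n : ℕ} {Z : Type u} [AddCommGroup Z] [Module A Z] (h : SyzRefl A B C n Z) :
    Module.Finite A Z := by
  cases n with
  | zero => exact Refl.finite h
  | succ n =>
    obtain ⟨F, _, _, π, _, _, hπ, _⟩ := h
    exact Module.Finite.of_surjective π hπ

-- A form of Schanuel's lemma, showing that the choice of projective covers is irrelevant. With
-- covers `π` of `Z` and `π'` of `Z'`, lift `ι` to `lam` and `r` to `ρ`. The composite `ρ ∘ lam`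
-- need not be the identity, but the difference lands in `ker π`. So `x ↦ ((lam x).1, x)` and `(y,
-- v) ↦ ρ (y, 0) + (v - ρ (lam v))` make `ker π` a retract of `ker π' × Aᵏ`, and the induction
-- continues.
include hA in
lemma SyzRefl.of_stable_retract {n : ℕ} : ∀ {Z Z' L : Type u} [AddCommGroup Z] [Module A Z]
    [AddCommGroup Z'] [Module A Z'] [AddCommGroup L] [Module A L] [Module.Finite A L]
    [Module.Projective A L], SyzRefl A B C n Z' → ∀ (ι : Z →ₗ[A] Z' × L) (r : Z' × L →ₗ[A] Z),
    r ∘ₗ ι = LinearMap.id → SyzRefl A B C n Z := by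
  induction n with
  | zero =>
    intro Z Z' L _ _ _ _ _ _ _ _ h ι r hr
    exact (Refl.prod h (hA.of_projective L)).of_retract ι r hr
  | succ n ih =>
    intro Z Z' L _ _ _ _ _ _ _ _ h ι r hr
    have := h.finite
    have hr' : ∀ z, r (ι z) = z := fun z => LinearMap.congr_fun hr z
    have : Module.Finite A Z := Module.Finite.of_surjective r fun z => ⟨ι z, hr' z⟩
    obtain ⟨F', _, _, π', _, _, hπ', hK'⟩ := h
    obtain ⟨k, π, hπ⟩ := Module.Finite.exists_fin' A Z
    have hp' : Function.Surjective (π'.prodMap (LinearMap.id : L →ₗ[A] L)) :=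
      Function.Surjective.prodMap hπ' Function.surjective_id
    obtain ⟨lam, hlam⟩ := Module.projective_lifting_property
      (π'.prodMap (LinearMap.id : L →ₗ[A] L)) (ι ∘ₗ π) hp'
    obtain ⟨ρ, hρ⟩ := Module.projective_lifting_property π
      (r ∘ₗ π'.prodMap (LinearMap.id : L →ₗ[A] L)) hπ
    have hlam₁ : ∀ x, π x = 0 → π' (lam x).1 = 0 := fun x hx => by
      have := congrArg Prod.fst (LinearMap.congr_fun hlam x)
      simpa [hx] using this
    have hlam₂ : ∀ x, π x = 0 → (lam x).2 = 0 := fun x hx => by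
      have := congrArg Prod.snd (LinearMap.congr_fun hlam x)
      simpa [hx] using this
    have hρ' : ∀ y, π (ρ y) = r (π' y.1, y.2) := fun y => LinearMap.congr_fun hρ y
    have hρlam : ∀ x, π (ρ (lam x)) = π x := fun x => by
      rw [hρ', ← hr' (π x)]
      exact congrArg r (LinearMap.congr_fun hlam x)
    refine ⟨Fin k → A, inferInstance, inferInstance, π, inferInstance, inferInstance, hπ, ?_⟩
    refine ih (L := Fin k → A) hK'
      (LinearMap.prod ((LinearMap.fst A F' L ∘ₗ lam).restrict (p := LinearMap.ker π)
        (q := LinearMap.ker π') (fun x hx => hlam₁ x hx)) (LinearMap.ker π).subtype)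
      (LinearMap.codRestrict (LinearMap.ker π)
        ((ρ ∘ₗ LinearMap.inl A F' L ∘ₗ (LinearMap.ker π').subtype).coprod
          (LinearMap.id - ρ ∘ₗ lam)) ?_) ?_
    · rintro ⟨⟨y, hy⟩, v⟩
      have hy' : π' y = 0 := hy
      simp [hρlam, hρ', hy', map_add, Prod.mk_zero_zero]
    · ext ⟨x, hx⟩ : 2
      have : lam x = ((lam x).1, 0) := Prod.ext rfl (hlam₂ x hx)
      change ρ ((lam x).1, 0) + (x - ρ (lam x)) = x
      rw [← this, add_sub_cancel]

include hA in
lemma SyzRefl.of_equiv {n : ℕ} {Z Z' : Type u} [AddCommGroup Z] [Module A Z]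
    [AddCommGroup Z'] [Module A Z'] (h : SyzRefl A B C n Z') (e : Z ≃ₗ[A] Z') :
    SyzRefl A B C n Z :=
  h.of_stable_retract hA (L := PUnit) (LinearMap.prod e.toLinearMap 0)
    (e.symm.toLinearMap ∘ₗ LinearMap.fst A _ _) (by ext; simp)

include hA in
lemma SyzRefl.prod {n : ℕ} {Z L : Type u} [AddCommGroup Z] [Module A Z]
    [AddCommGroup L] [Module A L] [Module.Finite A L] [Module.Projective A L]
    (h : SyzRefl A B C n Z) : SyzRefl A B C n (Z × L) :=
  h.of_stable_retract hA (L := L) LinearMap.id LinearMap.id (by ext <;> rfl)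

-- A cover `π : Aᵏ → Z` lifts to `X`; together with `f` it gives a surjection `K × Aᵏ → X` whose
-- kernel is `ker π`. The hypothesis `ih` is `SyzRefl.left` at level `n`, kept abstract because that
-- lemma is in turn proved by induction through this one.
include hA in
lemma syzRefl_succ_of_left {n : ℕ} (ih : ∀ {Y E X : Type u} [AddCommGroup Y] [Module A Y]
    [AddCommGroup E] [Module A E] [AddCommGroup X] [Module A X] (f : Y →ₗ[A] E) (g : E →ₗ[A] X),
    Function.Injective f → Function.Surjective g → Function.Exact f g → SyzRefl A B C n E →
      Refl A B C X → SyzRefl A B C n Y)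
    {K X Z : Type u} [AddCommGroup K] [Module A K] [AddCommGroup X] [Module A X]
    [AddCommGroup Z] [Module A Z] (f : K →ₗ[A] X) (g : X →ₗ[A] Z) (hf : Function.Injective f)
    (hg : Function.Surjective g) (hfg : Function.Exact f g) (hX : Refl A B C X)
    (hK : SyzRefl A B C n K) : SyzRefl A B C (n + 1) Z := by
  have := hX.finite
  have : Module.Finite A Z := Module.Finite.of_surjective g hg
  obtain ⟨k, π, hπ⟩ := Module.Finite.exists_fin' A Z
  obtain ⟨lam, hlam⟩ := Module.projective_lifting_property g π hg
  have hlam' : ∀ v, g (lam v) = π v := fun v => LinearMap.congr_fun hlam v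
  have hp : Function.Surjective (f.coprod lam) := by
    intro x
    obtain ⟨v, hv⟩ := hπ (g x)
    obtain ⟨a, ha⟩ := (hfg (x - lam v)).1 (by rw [map_sub, hlam', hv, sub_self])
    exact ⟨(a, v), by simp [ha]⟩
  have h1 : SyzRefl A B C n (LinearMap.ker (f.coprod lam)) :=
    ih (LinearMap.ker (f.coprod lam)).subtype (f.coprod lam) (Submodule.injective_subtype _) hp
      (f.coprod lam).exact_subtype_ker_map (hK.prod hA) hX
  let e : LinearMap.ker (f.coprod lam) →ₗ[A] LinearMap.ker π :=
    (LinearMap.snd A K (Fin k → A)).restrict (by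
      rintro ⟨a, v⟩ h
      have h : f a + lam v = 0 := by simpa using h
      have := congrArg g h
      simpa [hlam', hfg.apply_apply_eq_zero] using this)
  have he : Function.Bijective e := by
    constructor
    · rw [injective_iff_map_eq_zero]
      rintro ⟨⟨a, v⟩, h⟩ h0
      have hv : v = 0 := congrArg Subtype.val h0
      subst hv
      have : a = 0 := hf (by simpa using h)
      subst this
      rfl
    · rintro ⟨v, hv⟩
      obtain ⟨a, ha⟩ := (hfg (lam v)).1 (by rw [hlam']; exact hv)
      exact ⟨⟨(-a, v), by simp [ha]⟩, rfl⟩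
  exact ⟨Fin k → A, inferInstance, inferInstance, π, inferInstance, inferInstance, hπ,
    h1.of_equiv hA (LinearEquiv.ofBijective e he).symm⟩

variable [IsNoetherianRing A]

-- With a projective cover `π : F → E`, the kernel `Y'` of `F → X` is reflexive, and `0 → ker π → Y'
-- → Y → 0` is exact. This is the input of `syzRefl_succ_of_left`.
include hA in
lemma SyzRefl.left {n : ℕ} : ∀ {Y E X : Type u} [AddCommGroup Y] [Module A Y]
    [AddCommGroup E] [Module A E] [AddCommGroup X] [Module A X] (f : Y →ₗ[A] E) (g : E →ₗ[A] X),
    Function.Injective f → Function.Surjective g → Function.Exact f g → SyzRefl A B C n E →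
      Refl A B C X → SyzRefl A B C n Y := by
  induction n with
  | zero =>
    intro Y E X _ _ _ _ _ _ f g hf hg hfg hE hX
    have := hE.finite
    exact Refl.left hf hg hfg (Module.Finite.of_injective f hf) hE hX
  | succ n ih =>
    intro Y E X _ _ _ _ _ _ f g hf hg hfg hE hX
    obtain ⟨F, _, _, π, _, _, hπ, hK⟩ := hE
    have hY' : Refl A B C (LinearMap.ker (g ∘ₗ π)) :=
      Refl.left (Submodule.injective_subtype _) (hg.comp hπ) (g ∘ₗ π).exact_subtype_ker_map
        (Module.Finite.of_injective _ (Submodule.injective_subtype _)) (hA.of_projective F) hX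
    let e := LinearEquiv.ofInjective f hf
    let h : LinearMap.ker (g ∘ₗ π) →ₗ[A] Y := e.symm.toLinearMap ∘ₗ
      π.restrict (p := LinearMap.ker (g ∘ₗ π)) (q := LinearMap.range f)
        (fun x hx => (hfg (π x)).1 hx)
    have hh : ∀ x, f (h x) = π x := fun x => by
      have := congrArg Subtype.val (e.apply_symm_apply ⟨π x, (hfg (π x)).1 x.2⟩)
      exact this
    have hle : LinearMap.ker π ≤ LinearMap.ker (g ∘ₗ π) := LinearMap.ker_le_ker_comp _ _
    refine syzRefl_succ_of_left hA ih (Submodule.inclusion hle) h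
      (Submodule.inclusion_injective hle) ?_ ?_ hY' hK
    · intro y
      obtain ⟨v, hv⟩ := hπ (f y)
      exact ⟨⟨v, by simp [hv, hfg.apply_apply_eq_zero]⟩, hf ((hh _).trans hv)⟩
    · intro v
      constructor
      · intro hv
        exact ⟨⟨v.1, by rw [LinearMap.mem_ker, ← hh, hv, map_zero]⟩, rfl⟩
      · rintro ⟨w, rfl⟩
        exact hf (by rw [hh, map_zero]; exact w.2)

include hA in
lemma SyzRefl.succ {n : ℕ} {K X Z : Type u} [AddCommGroup K] [Module A K] [AddCommGroup X]
    [Module A X] [AddCommGroup Z] [Module A Z] (f : K →ₗ[A] X) (g : X →ₗ[A] Z)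
    (hf : Function.Injective f) (hg : Function.Surjective g) (hfg : Function.Exact f g)
    (hX : Refl A B C X) (hK : SyzRefl A B C n K) : SyzRefl A B C (n + 1) Z :=
  syzRefl_succ_of_left hA (SyzRefl.left hA) f g hf hg hfg hX hK

include hA in
lemma SyzRefl.succ_iff {n : ℕ} {K X Z : Type u} [AddCommGroup K] [Module A K] [AddCommGroup X]
    [Module A X] [AddCommGroup Z] [Module A Z] [Module.Finite A X] [Module.Projective A X]
    (f : K →ₗ[A] X) (g : X →ₗ[A] Z)
    (hf : Function.Injective f) (hg : Function.Surjective g) (hfg : Function.Exact f g) :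
    SyzRefl A B C (n + 1) Z ↔ SyzRefl A B C n K := by
  refine ⟨?_, SyzRefl.succ hA f g hf hg hfg (hA.of_projective X)⟩
  rintro ⟨F, _, _, π, _, _, hπ, hK⟩
  obtain ⟨a, ha⟩ := Module.projective_lifting_property π g hπ
  obtain ⟨b, hb⟩ := Module.projective_lifting_property g π hg
  have ha' : ∀ x, π (a x) = g x := LinearMap.congr_fun ha
  have hb' : ∀ x, g (b x) = π x := LinearMap.congr_fun hb
  have hgf : ∀ x, g (f x) = 0 := hfg.apply_apply_eq_zero
  have h1 : SyzRefl A B C n (LinearMap.ker g) := by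
    refine hK.of_stable_retract hA (L := X)
      (LinearMap.prod (a.restrict (fun x (hx : g x = 0) => by
        rw [LinearMap.mem_ker, ha', hx])) (LinearMap.ker g).subtype)
      (LinearMap.codRestrict (LinearMap.ker g)
        ((b ∘ₗ (LinearMap.ker π).subtype).coprod (LinearMap.id - b ∘ₗ a)) ?_) ?_
    · rintro ⟨⟨y, hy⟩, v⟩
      have hy : π y = 0 := hy
      simp [hb', ha', hy]
    · ext x : 2
      change b (a x) + (x - b (a x)) = x
      rw [add_sub_cancel]
  refine h1.of_equiv hA (LinearEquiv.ofBijective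
    (f.codRestrict (LinearMap.ker g) hgf) ⟨fun x y h => hf (congrArg Subtype.val h), ?_⟩)
  rintro ⟨x, hx⟩
  obtain ⟨k, rfl⟩ := (hfg x).1 hx
  exact ⟨k, rfl⟩

end Syzygies

section

variable {R S : Type u} [Ring R] [Ring S]
  {C : Type u} [AddCommGroup C] [Module R C]
  [Module Sᵐᵒᵖ C] [SMulCommClass R Sᵐᵒᵖ C] [SMulCommClass Sᵐᵒᵖ R C]

/-- Each reflexive term is traded for a projective one by `SyzRefl.succ`, applied to the kernel of
the augmentation. -/
lemma HasReflexiveResolution.syzRefl [IsNoetherianRing R] (hR : Refl R Sᵐᵒᵖ C R) {n : ℕ} :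
    ∀ {T : ModuleCat.{u} R}, HasReflexiveResolution R S C T n → SyzRefl R Sᵐᵒᵖ C n T := by
  induction n with
  | zero =>
    rintro T ⟨X, d, ε, hX, h0, hε, hd, -⟩
    have := h0 1 one_pos
    have hinj : Function.Injective ε := by
      rw [injective_iff_map_eq_zero]
      intro x hx
      obtain ⟨y, rfl⟩ := (hd x).1 hx
      rw [Subsingleton.elim y 0, map_zero]
    exact ((isReflexive_iff (X 0)).1 (hX 0 le_rfl)).of_equiv
      (LinearEquiv.ofBijective ε ⟨hinj, hε⟩).symm
  | succ n ih =>
    rintro T ⟨X, d, ε, hX, h0, hε, hd, hdd⟩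
    refine SyzRefl.succ hR (LinearMap.ker ε).subtype ε (Submodule.injective_subtype _) hε
      ε.exact_subtype_ker_map ((isReflexive_iff (X 0)).1 (hX 0 (by omega)))
      (ih (T := ModuleCat.of R (LinearMap.ker ε)) ⟨fun k => X (k + 1), fun k => d (k + 1),
        (d 0).codRestrict (LinearMap.ker ε) hd.apply_apply_eq_zero, fun k hk => hX _ (by omega),
        fun k hk => h0 _ (by omega), ?_, ?_, fun k => hdd (k + 1)⟩)
    · rintro ⟨x, hx⟩
      obtain ⟨y, rfl⟩ := (hd x).1 hx
      exact ⟨y, rfl⟩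
    · intro x
      rw [← hdd 0 x]
      exact Subtype.ext_iff

lemma SyzRefl.hasReflexiveResolution (hR : Refl R Sᵐᵒᵖ C R) {n : ℕ} : ∀ {T : ModuleCat.{u} R},
    SyzRefl R Sᵐᵒᵖ C n T → HasReflexiveResolution R S C T n := by
  induction n with
  | zero =>
    intro T hT
    refine ⟨fun k => Nat.rec T (fun _ _ => ModuleCat.of R PUnit) k, fun k => 0, LinearMap.id,
      ?_, ?_, Function.surjective_id, ?_, ?_⟩
    · intro k hk
      obtain rfl : k = 0 := by omega
      exact (isReflexive_iff T).2 hT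
    · intro k hk
      obtain ⟨k, rfl⟩ := Nat.exists_eq_succ_of_ne_zero hk.ne'
      exact inferInstanceAs (Subsingleton PUnit)
    · intro x
      simpa using eq_comm
    · intro k x
      exact ⟨fun _ => ⟨0, @Subsingleton.elim PUnit.{u + 1} inferInstance _ _⟩, fun _ => rfl⟩
  | succ n ih =>
    rintro T ⟨F, _, _, π, _, _, hπ, hK⟩
    obtain ⟨X, d, ε, hX, h0, hε, hd, hdd⟩ := ih (T := ModuleCat.of R (LinearMap.ker π)) hK
    refine ⟨fun k => Nat.rec (ModuleCat.of R F) (fun k _ => X k) k,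
      fun k => Nat.rec ((LinearMap.ker π).subtype ∘ₗ ε) (fun k _ => d k) k, π,
      ?_, ?_, hπ, ?_, ?_⟩
    · rintro (_ | k) hk
      · exact (isReflexive_iff _).2 (hR.of_projective F)
      · exact hX k (by omega)
    · rintro (_ | k) hk
      · omega
      · exact h0 k (by omega)
    · intro x
      constructor
      · intro hx
        obtain ⟨y, hy⟩ := hε ⟨x, hx⟩
        exact ⟨y, congrArg Subtype.val hy⟩
      · rintro ⟨y, rfl⟩
        exact (ε y).2
    · rintro (_ | k)
      · intro x
        rw [← hd x]
        exact (Subtype.ext_iff (a1 := ε x) (a2 := 0)).symm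
      · exact hdd k

end

/-! ### Cohomology, quasi-isomorphisms and mapping cones on elements -/

section Elementwise

variable {A : Type u} [Ring A] {K L : CochainComplex (ModuleCat.{u} A) ℤ}

lemma exactAt_iff_exact {i j k : ℤ} (hij : i + 1 = j) (hjk : j + 1 = k) :
    K.ExactAt j ↔ Function.Exact (K.d i j) (K.d j k) := by
  rw [K.exactAt_iff' i j k (by simp; omega) (by simp; omega),
    ShortComplex.ShortExact.moduleCat_exact_iff_function_exact]
  rfl

lemma d_d_apply (i j k : ℤ) (x : K.X i) : K.d j k (K.d i j x) = 0 := by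
  rw [← ModuleCat.comp_apply, K.d_comp_d]; rfl

lemma d_hom_apply (φ : K ⟶ L) (i j : ℤ) (x : K.X i) :
    L.d i j (φ.f i x) = φ.f j (K.d i j x) := by
  rw [← ModuleCat.comp_apply, ← ModuleCat.comp_apply, φ.comm]

lemma exists_iCycles_eq {j k : ℤ} (hjk : j + 1 = k) (x : K.X j) (hx : K.d j k x = 0) :
    ∃ z : K.cycles j, K.iCycles j z = x := by
  have h := (ShortComplex.ShortExact.moduleCat_exact_iff_function_exact _).1
    (ShortComplex.exact_of_f_is_kernel (ShortComplex.mk (K.iCycles j) (K.d j k) (by simp))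
      (K.cyclesIsKernel j k (by simp; omega)))
  exact (h x).1 hx

lemma iCycles_injective (j : ℤ) : Function.Injective (K.iCycles j) :=
  (ModuleCat.mono_iff_injective _).1 inferInstance

lemma homologyπ_surjective (j : ℤ) : Function.Surjective (K.homologyπ j) :=
  (ModuleCat.epi_iff_surjective _).1 inferInstance

lemma d_iCycles_apply (j k : ℤ) (z : K.cycles j) : K.d j k (K.iCycles j z) = 0 := by
  rw [← ModuleCat.comp_apply, K.iCycles_d]; rfl

lemma homologyπ_eq_zero_iff {i j : ℤ} (hij : i + 1 = j) (z : K.cycles j) :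
    K.homologyπ j z = 0 ↔ ∃ x : K.X i, K.d i j x = K.iCycles j z := by
  have h := (ShortComplex.ShortExact.moduleCat_exact_iff_function_exact _).1
    (ShortComplex.exact_of_g_is_cokernel
      (ShortComplex.mk (K.toCycles i j) (K.homologyπ j) (by simp))
      (K.homologyIsCokernel i j (by simp; omega)))
  refine (h z).trans (exists_congr fun x => ?_)
  rw [← K.toCycles_i i j, ModuleCat.comp_apply]
  exact (iCycles_injective j).eq_iff.symm

lemma quasiIsoAt_iff_elements (φ : K ⟶ L) {i j k : ℤ} (hij : i + 1 = j) (hjk : j + 1 = k) :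
    QuasiIsoAt φ j ↔
      (∀ x : K.X j, K.d j k x = 0 → (∃ y : L.X i, L.d i j y = φ.f j x) →
        ∃ x' : K.X i, K.d i j x' = x) ∧
      (∀ y : L.X j, L.d j k y = 0 →
        ∃ x : K.X j, K.d j k x = 0 ∧ ∃ y' : L.X i, L.d i j y' = y - φ.f j x) := by
  have hπ : ∀ z : K.cycles j, HomologicalComplex.homologyMap φ j (K.homologyπ j z) =
      L.homologyπ j (HomologicalComplex.cyclesMap φ j z) := fun z => by
    rw [← ModuleCat.comp_apply, ← ModuleCat.comp_apply, HomologicalComplex.homologyπ_naturality]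
  have hι : ∀ z : K.cycles j, L.iCycles j (HomologicalComplex.cyclesMap φ j z) =
      φ.f j (K.iCycles j z) := fun z => by
    rw [← ModuleCat.comp_apply, ← ModuleCat.comp_apply, HomologicalComplex.cyclesMap_i]
  rw [quasiIsoAt_iff_isIso_homologyMap, ConcreteCategory.isIso_iff_bijective]
  constructor
  · rintro ⟨h1, h2⟩
    constructor
    · rintro x hx ⟨y, hy⟩
      obtain ⟨z, rfl⟩ := exists_iCycles_eq hjk x hx
      refine (homologyπ_eq_zero_iff hij z).1 (h1 ?_)
      rw [map_zero, hπ, homologyπ_eq_zero_iff hij]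
      exact ⟨y, by rw [hy, hι]⟩
    · intro y hy
      obtain ⟨w, rfl⟩ := exists_iCycles_eq hjk y hy
      obtain ⟨t, ht⟩ := h2 (L.homologyπ j w)
      obtain ⟨z, rfl⟩ := homologyπ_surjective j t
      refine ⟨K.iCycles j z, d_iCycles_apply j k z, ?_⟩
      rw [← hι, ← map_sub]
      exact (homologyπ_eq_zero_iff hij _).1 (by rw [map_sub, ← ht, hπ, sub_self])
  · rintro ⟨h1, h2⟩
    constructor
    · rw [injective_iff_map_eq_zero]
      intro t ht
      obtain ⟨z, rfl⟩ := homologyπ_surjective j t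
      rw [hπ, homologyπ_eq_zero_iff hij, hι] at ht
      exact (homologyπ_eq_zero_iff hij z).2 (h1 _ (d_iCycles_apply j k z) ht)
    · intro t
      obtain ⟨w, rfl⟩ := homologyπ_surjective j t
      obtain ⟨x, hx, hy⟩ := h2 _ (d_iCycles_apply j k w)
      obtain ⟨z, rfl⟩ := exists_iCycles_eq hjk x hx
      refine ⟨K.homologyπ j z, ?_⟩
      rw [← hι, ← map_sub] at hy
      have := (homologyπ_eq_zero_iff hij _).2 hy
      rw [map_sub, sub_eq_zero] at this
      rw [hπ, this]

/-- The differential of the mapping cone of `φ`, whose term in degree `i` is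
`Kⁱ⁺¹ × Lⁱ`. -/
def coneD (φ : K ⟶ L) (i j k : ℤ) : (K.X j × L.X i) →ₗ[A] (K.X k × L.X j) :=
  LinearMap.prod (-(K.d j k).hom ∘ₗ LinearMap.fst A _ _) ((φ.f j).hom.coprod (L.d i j).hom)

@[simp]
lemma coneD_apply (φ : K ⟶ L) (i j k : ℤ) (e : K.X j × L.X i) :
    coneD φ i j k e = (-K.d j k e.1, φ.f j e.1 + L.d i j e.2) := rfl

lemma coneD_coneD (φ : K ⟶ L) (i j k l : ℤ) (e : K.X j × L.X i) :
    coneD φ j k l (coneD φ i j k e) = 0 := by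
  ext
  · simp [d_d_apply]
  · simp [d_d_apply, d_hom_apply]

lemma quasiIso_iff_cone_exact (φ : K ⟶ L) :
    QuasiIso φ ↔ ∀ i j k l : ℤ, i + 1 = j → j + 1 = k → k + 1 = l →
      Function.Exact (coneD φ i j k) (coneD φ j k l) := by
  rw [quasiIso_iff]
  constructor
  · intro h i j k l hij hjk hkl e
    constructor
    swap
    · rintro ⟨e', rfl⟩
      exact coneD_coneD _ _ _ _ _ _
    obtain ⟨q, x⟩ := e
    intro he
    have h1 : K.d k l q = 0 := by simpa using congrArg Prod.fst he
    have h2 : φ.f k q + L.d j k x = 0 := congrArg Prod.snd he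
    obtain ⟨q', rfl⟩ := ((quasiIsoAt_iff_elements φ hjk hkl).1 (h k)).1 q h1
      ⟨-x, by rw [map_neg, eq_comm, ← add_eq_zero_iff_eq_neg]; exact h2⟩
    obtain ⟨q'', hq, y, hy⟩ := ((quasiIsoAt_iff_elements φ hij hjk).1 (h j)).2 (φ.f j q' + x)
      (by rw [map_add, d_hom_apply]; exact h2)
    refine ⟨(q'' - q', y), ?_⟩
    ext
    · simp [hq]
    · simp [hy]
  · intro h j
    rw [quasiIsoAt_iff_elements φ (i := j - 1) (k := j + 1) (by omega) rfl]
    constructor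
    · rintro x hx ⟨y, hy⟩
      obtain ⟨⟨q', _⟩, he⟩ := (h (j - 1 - 1) (j - 1) j (j + 1) (by omega) (by omega) rfl
        (x, -y)).1 (by ext <;> simp [hx, hy])
      exact ⟨-q', by simpa using congrArg Prod.fst he⟩
    · intro y hy
      obtain ⟨⟨q', y'⟩, he⟩ := (h (j - 1) j (j + 1) (j + 1 + 1) (by omega) rfl rfl
        (0, y)).1 (by ext <;> simp [hy])
      refine ⟨q', by simpa using congrArg Prod.fst he, y', ?_⟩
      have : φ.f j q' + L.d (j - 1) j y' = y := congrArg Prod.snd he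
      rw [← this, add_sub_cancel_left]

end Elementwise

/-! ### Dualizing complexes and mapping cones -/

section Dual

variable {A B C : Type u} [Ring A] [Ring B] [AddCommGroup C] [Module A C] [Module B C]
  [SMulCommClass A B C]

lemma dual_exactAt_iff {K : CochainComplex (ModuleCat.{u} A) ℤ} {n a b c : ℤ} (hab : a + 1 = b)
    (hbc : b + 1 = c) (hn : n + b = 0) :
    (dual B C K).ExactAt n ↔
      Function.Exact (dualLin A B C (K.d b c).hom) (dualLin A B C (K.d a b).hom) := by
  obtain rfl : b = -n := by omega
  obtain rfl : a = -(n + 1) := by omega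
  obtain rfl : c = -(n - 1) := by omega
  exact exactAt_iff_exact (K := dual B C K) (i := n - 1) (by omega) rfl

/-- Up to signs and a shift, the cone of the dual map is `Hom(cone φ, C)`; the right-hand side is
exactness of that complex. -/
lemma quasiIso_dualMap_iff {K L : CochainComplex (ModuleCat.{u} A) ℤ} (φ : K ⟶ L) :
    QuasiIso (dualMap B C φ) ↔ ∀ i j k l : ℤ, i + 1 = j → j + 1 = k → k + 1 = l →
      ∀ f : (K.X k × L.X j) →ₗ[A] C, f ∘ₗ coneD φ i j k = 0 →
        ∃ h : (K.X l × L.X k) →ₗ[A] C, h ∘ₗ coneD φ j k l = f := by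
  rw [quasiIso_iff_cone_exact]
  constructor
  · intro H i j k l hij hjk hkl f hf
    obtain ⟨i', rfl⟩ : ∃ i', i = -i' := ⟨-i, by omega⟩
    obtain ⟨j', rfl⟩ : ∃ i', j = -i' := ⟨-j, by omega⟩
    obtain ⟨k', rfl⟩ : ∃ i', k = -i' := ⟨-k, by omega⟩
    obtain ⟨l', rfl⟩ : ∃ i', l = -i' := ⟨-l, by omega⟩
    let α : L.X (-j') →ₗ[A] C := f ∘ₗ LinearMap.inr A _ _
    let β : K.X (-k') →ₗ[A] C := f ∘ₗ LinearMap.inl A _ _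
    have hα : ∀ y, α y = f (0, y) := fun y => rfl
    have hβ : ∀ y, β y = f (y, 0) := fun y => rfl
    have hadd : ∀ e, f e = β e.1 + α e.2 := fun e => by simp [hα, hβ, ← map_add]
    have hf' : ∀ e, f (coneD φ _ _ _ e) = 0 := fun e => LinearMap.congr_fun hf e
    -- Dualizing swaps the two components of the cone, while in both cones the sign sits on the
    -- first one; the sign of `β` compensates.
    obtain ⟨⟨α', β'⟩, he⟩ := (H l' k' j' i' (by omega) (by omega) (by omega) (α, -β)).1 (by
      refine Prod.ext (LinearMap.ext fun y => ?_) (LinearMap.ext fun x => ?_)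
      · change -(α (L.d _ _ y)) = 0
        have := hf' (0, y)
        simp only [hadd, coneD_apply, map_zero, neg_zero, zero_add] at this
        rw [this, neg_zero]
      · change α (φ.f _ x) + -(β (K.d _ _ x)) = 0
        have := hf' (x, 0)
        simp only [hadd, coneD_apply, map_zero, map_neg, add_zero] at this
        rw [add_comm]; exact this)
    let a : L.X (-k') →ₗ[A] C := α'
    let b : K.X (-l') →ₗ[A] C := β'
    have h1 : ∀ y, -(a (L.d _ _ y)) = α y := fun y =>
      congrArg (fun t : L.X (-j') →ₗ[A] C => t y) (congrArg Prod.fst he)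
    have h2 : ∀ x, a (φ.f _ x) + b (K.d _ _ x) = -β x := fun x =>
      congrArg (fun t : K.X (-k') →ₗ[A] C => t x) (congrArg Prod.snd he)
    refine ⟨b.coprod (-a), ?_⟩
    ext x
    · have := h2 x
      simp only [LinearMap.comp_apply, LinearMap.inl_apply, coneD_apply, LinearMap.coprod_apply,
        map_zero, add_zero, map_neg, LinearMap.neg_apply]
      rw [← hβ, ← neg_add_rev, this, neg_neg]
    · have := h1 x
      simp only [LinearMap.comp_apply, LinearMap.inr_apply, coneD_apply, LinearMap.coprod_apply,
        map_zero, zero_add, LinearMap.neg_apply, neg_zero]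
      rw [← hα, ← this]
  · intro H l k j i hlk hkj hji e
    constructor
    swap
    · rintro ⟨e', rfl⟩
      exact coneD_coneD _ _ _ _ _ _
    obtain ⟨α, β⟩ := e
    intro he
    let a : L.X (-j) →ₗ[A] C := α
    let b : K.X (-k) →ₗ[A] C := β
    have h1 : ∀ y, -(a (L.d (-i) (-j) y)) = 0 := fun y =>
      congrArg (fun t : L.X (-i) →ₗ[A] C => t y) (congrArg Prod.fst he)
    have h2 : ∀ x, a (φ.f (-j) x) + b (K.d (-j) (-k) x) = 0 := fun x =>
      congrArg (fun t : K.X (-j) →ₗ[A] C => t x) (congrArg Prod.snd he)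
    obtain ⟨f, hf⟩ := H (-i) (-j) (-k) (-l) (by omega) (by omega) (by omega)
      ((-b).coprod a) (by
        ext x
        · have := h2 x
          simp only [LinearMap.comp_apply, LinearMap.inl_apply, coneD_apply,
            LinearMap.coprod_apply, map_zero, add_zero, map_neg, LinearMap.neg_apply, neg_neg]
          rw [add_comm]; exact this
        · have := h1 x
          simpa using this)
    have hf' : ∀ e, f (coneD φ _ _ _ e) = _ := fun e => LinearMap.congr_fun hf e
    have hadd : ∀ e, f e = f (e.1, 0) + f (0, e.2) := fun e => by simp [← map_add]
    refine ⟨((-(f ∘ₗ LinearMap.inr A _ _) : L.X (-k) →ₗ[A] C),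
      (f ∘ₗ LinearMap.inl A _ _ : K.X (-l) →ₗ[A] C)), ?_⟩
    refine Prod.ext (LinearMap.ext fun y => ?_) (LinearMap.ext fun x => ?_)
    · change -(-(f (0, L.d _ _ y))) = a y
      have := hf' (0, y)
      simpa using this
    · change -(f (0, φ.f _ x)) + f (K.d _ _ x, 0) = b x
      have := hf' (x, 0)
      rw [hadd] at this
      simp only [coneD_apply, map_zero, add_zero, LinearMap.coprod_apply,
        LinearMap.neg_apply] at this
      have h3 : f (-K.d (-k) (-l) x, 0) = - f (K.d (-k) (-l) x, 0) := by
        rw [← map_neg f, Prod.neg_mk, neg_zero]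
      rw [h3] at this
      rw [← neg_inj, ← this]
      abel

lemma isIso_bidualMap [SMulCommClass B A C] {K : CochainComplex (ModuleCat.{u} A) ℤ}
    (h : ∀ n, Function.Bijective (evalMap (A := A) B C (K.X n))) : IsIso (bidualMap B C K) := by
  have : ∀ n, IsIso ((bidualMap B C K).f n) := by
    intro n
    have : IsIso (ModuleCat.ofHom (evalMap (A := A) B C (K.X (-(-n))))) :=
      (ConcreteCategory.isIso_iff_bijective _).2 (h _)
    change IsIso ((K.XIsoOfEq (neg_neg n).symm).hom ≫
      ModuleCat.ofHom (evalMap (A := A) B C (K.X (-(-n)))))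
    infer_instance
  exact HomologicalComplex.Hom.isIso_of_components _

end Dual

/-! ### Cokernels of a projective complex as syzygies -/

section Cokernels

variable {A : Type u} [Ring A]

/-- `P` is a bounded above complex of finitely generated projective modules. -/
structure IsFGProjComplex (P : CochainComplex (ModuleCat.{u} A) ℤ) : Prop where
  finite (n : ℤ) : Module.Finite A (P.X n)
  projective (n : ℤ) : Module.Projective A (P.X n)
  boundedAbove : ∃ N : ℤ, ∀ n : ℤ, N < n → Subsingleton (P.X n)

lemma IsProjRes.isFGProjComplex {P K : CochainComplex (ModuleCat.{u} A) ℤ} {f : P ⟶ K}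
    (h : IsProjRes f) : IsFGProjComplex P :=
  ⟨h.finite, h.projective, h.boundedAbove⟩

/-- The cokernel of the differential `P^{j-1} → P^j`. -/
abbrev Cok (P : CochainComplex (ModuleCat.{u} A) ℤ) (j : ℤ) : Type u :=
  P.X j ⧸ LinearMap.range (P.d (j - 1) j).hom

variable {P : CochainComplex (ModuleCat.{u} A) ℤ}

lemma range_d_eq {i i' j : ℤ} (h : i = i') :
    LinearMap.range (P.d i j).hom = LinearMap.range (P.d i' j).hom := by
  subst h; rfl

/-- The map `coker(P^{j-2} → P^{j-1}) → P^j` induced by the differential. -/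
def cokD (P : CochainComplex (ModuleCat.{u} A) ℤ) (j : ℤ) : Cok P (j - 1) →ₗ[A] P.X j :=
  (LinearMap.range (P.d (j - 1 - 1) (j - 1)).hom).liftQ (P.d (j - 1) j).hom (by
    rintro _ ⟨x, rfl⟩
    exact d_d_apply _ _ _ x)

@[simp]
lemma cokD_mk (j : ℤ) (x : P.X (j - 1)) : cokD P j (Submodule.Quotient.mk x) = P.d (j - 1) j x :=
  rfl

/-- With `cokD_exact` this gives `0 → Cok P (j-1) → P^j → Cok P j → 0`: lowering `j` by one takes a
syzygy. -/
lemma cokD_injective {j : ℤ} (h : P.ExactAt (j - 1)) : Function.Injective (cokD P j) := by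
  rw [injective_iff_map_eq_zero]
  intro x hx
  obtain ⟨x, rfl⟩ := Submodule.Quotient.mk_surjective _ x
  rw [cokD_mk] at hx
  rw [Submodule.Quotient.mk_eq_zero]
  exact ((exactAt_iff_exact (by omega) (by omega)).1 h x).1 hx

lemma cokD_exact (j : ℤ) :
    Function.Exact (cokD P j) (LinearMap.range (P.d (j - 1) j).hom).mkQ := by
  intro x
  rw [Submodule.mkQ_apply, Submodule.Quotient.mk_eq_zero]
  constructor
  · rintro ⟨y, rfl⟩
    exact ⟨Submodule.Quotient.mk y, rfl⟩
  · rintro ⟨y, rfl⟩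
    obtain ⟨y, rfl⟩ := Submodule.Quotient.mk_surjective _ y
    exact ⟨y, rfl⟩

end Cokernels

section CokernelsReflexive

variable {A B C : Type u} [Ring A] [Ring B] [AddCommGroup C] [Module A C] [Module B C]
  [SMulCommClass A B C] {P : CochainComplex (ModuleCat.{u} A) ℤ}

/-- Degrees `≤ j` of `P` form a projective resolution of `Cok P j`. For `p = 0`, both sides say that
every map `Cok P (j-1) → C` extends to `P^j`; larger `p` follows by dimension shifting. -/
lemma extZero_cok_iff (hP : IsFGProjComplex P) {p : ℕ} : ∀ {n j : ℤ},
    (∀ i < j, P.ExactAt i) → n = -j + (p + 1) →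
      (ExtZero A C (Cok P j) (p + 1) ↔ (dual B C P).ExactAt n) := by
  have := hP.projective
  induction p with
  | zero =>
    intro n j hj hn
    have hinj := cokD_injective (hj (j - 1) (by omega))
    have hsurj := Submodule.mkQ_surjective (LinearMap.range (P.d (j - 1) j).hom)
    rw [dual_exactAt_iff (B := B) (C := C) (n := n) (a := j - 1 - 1) (b := j - 1) (c := j)
      (by omega) (by omega) (by push_cast at hn; omega)]
    constructor
    · intro h f
      constructor
      · intro hf
        have hf' : ∀ x, f (P.d (j - 1 - 1) (j - 1) x) = 0 := fun x => LinearMap.congr_fun hf x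
        obtain ⟨ψ, hψ⟩ := exists_extension_of_extZero_one hinj hsurj (cokD_exact j) h
          ((LinearMap.range (P.d (j - 1 - 1) (j - 1)).hom).liftQ f (by
            rintro _ ⟨x, rfl⟩
            exact hf' x))
        refine ⟨ψ, ?_⟩
        ext x
        exact LinearMap.congr_fun hψ (Submodule.Quotient.mk x)
      · rintro ⟨g, rfl⟩
        ext x
        change g (P.d (j - 1) j (P.d (j - 1 - 1) (j - 1) x)) = 0
        rw [d_d_apply, map_zero]
    · intro h
      refine extZero_one_of_extends hinj hsurj (cokD_exact j)
        (extVanish_of_projective _ 1 one_pos) fun φ => ?_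
      obtain ⟨ψ, hψ⟩ := (h (φ ∘ₗ Submodule.mkQ _)).1 (by
        ext x
        change φ (Submodule.Quotient.mk (P.d (j - 1 - 1) (j - 1) x)) = 0
        have hx : (Submodule.Quotient.mk (P.d (j - 1 - 1) (j - 1) x) : Cok P (j - 1)) = 0 :=
          (Submodule.Quotient.mk_eq_zero _).2 ⟨x, rfl⟩
        rw [hx, map_zero])
      refine ⟨ψ, ?_⟩
      ext x
      exact LinearMap.congr_fun hψ x
  | succ p ih =>
    intro n j hj hn
    have hinj := cokD_injective (hj (j - 1) (by omega))
    have hsurj := Submodule.mkQ_surjective (LinearMap.range (P.d (j - 1) j).hom)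
    rw [← ih (n := n) (j := j - 1) (fun i hi => hj i (by omega)) (by push_cast at hn ⊢; omega)]
    exact ⟨extZero_left_of_right hinj hsurj (cokD_exact j)
      (extVanish_of_projective _ _ (by omega)), extZero_right_of_left hinj hsurj (cokD_exact j)
      (extVanish_of_projective _ _ (by omega))⟩

lemma extVanish_cok_iff (hP : IsFGProjComplex P) {n j : ℤ} (hj : ∀ i < j, P.ExactAt i)
    (hn : n + j = 0) :
    ExtVanish A C (Cok P j) ↔ ∀ m, n < m → (dual B C P).ExactAt m := by
  constructor
  · intro h m hm
    obtain ⟨p, hp⟩ := Int.eq_ofNat_of_zero_le (show 0 ≤ m - n - 1 by omega)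
    exact (extZero_cok_iff hP hj (by omega)).1 (h (p + 1) (by omega))
  · intro h i hi
    obtain ⟨p, rfl⟩ := Nat.exists_eq_succ_of_ne_zero hi.ne'
    exact (extZero_cok_iff hP hj rfl).2 (h _ (by omega))

variable [SMulCommClass B A C]

lemma Refl.cok_pred [IsNoetherianRing A] (hA : Refl A B C A) (hP : IsFGProjComplex P) {j : ℤ}
    (hj : P.ExactAt (j - 1)) (h : Refl A B C (Cok P j)) : Refl A B C (Cok P (j - 1)) := by
  have := hP.finite
  have := hP.projective
  exact Refl.left (cokD_injective hj) (Submodule.mkQ_surjective _) (cokD_exact j)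
    (Module.Finite.of_injective _ (cokD_injective hj)) (hA.of_projective _) h

lemma Refl.cok_le [IsNoetherianRing A] (hA : Refl A B C A) (hP : IsFGProjComplex P) {j : ℤ}
    (hj : ∀ i < j, P.ExactAt i) (h : Refl A B C (Cok P j)) {k : ℤ} (hk : k ≤ j) :
    Refl A B C (Cok P k) := by
  induction k, hk using Int.leInductionDown with
  | base => exact h
  | pred k hk ih => exact Refl.cok_pred hA hP (hj _ (by omega)) ih

/-- Climbing from `l` to `l + 1` by `Refl.right` needs Ext vanishing of the new cokernel. It is
inherited from `Cok P j`, since the relevant cohomology of `Hom(P, C)` lies in degrees above `-j`.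
-/
lemma Refl.cok_ge (hA : Refl A B C A) (hP : IsFGProjComplex P) {j k : ℤ} (hk : k ≤ j)
    (hj : ∀ i < j, P.ExactAt i) (hext : ExtVanish A C (Cok P j))
    (h : Refl A B C (Cok P k)) : Refl A B C (Cok P j) := by
  have := hP.finite
  have := hP.projective
  have hd := (extVanish_cok_iff (B := B) hP (n := -j) hj (by omega)).1 hext
  have key : ∀ l, k ≤ l → l ≤ j → Refl A B C (Cok P l) := by
    intro l hl
    induction l, hl using Int.leInduction with
    | base => exact fun _ => h
    | succ l hl ih =>
      intro hlj
      have h1 := ih (by omega)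
      obtain ⟨m, rfl⟩ : ∃ m, l = m - 1 := ⟨l + 1, by omega⟩
      rw [sub_add_cancel] at hlj ⊢
      exact Refl.right (cokD_injective (hj _ (by omega))) (Submodule.mkQ_surjective _)
        (cokD_exact m) h1 (hA.of_projective _)
        ((extVanish_cok_iff (B := B) hP (n := -m) (fun i hi => hj i (by omega)) (by omega)).2
          fun p hp => hd p (by omega))
  exact key j hk le_rfl

/-- `Cok P (j - n)` is an `n`-th syzygy of `Cok P j`, and by `SyzRefl.succ_iff` any one choice of
syzygy decides. -/
lemma syzRefl_cok_iff [IsNoetherianRing A] (hA : Refl A B C A) (hP : IsFGProjComplex P)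
    {n : ℕ} : ∀ {j k : ℤ}, (∀ i < j, P.ExactAt i) → k = j - n →
      (SyzRefl A B C n (Cok P j) ↔ Refl A B C (Cok P k)) := by
  have := hP.finite
  have := hP.projective
  induction n with
  | zero =>
    intro j k hj hk
    obtain rfl : k = j := by simpa using hk
    rfl
  | succ n ih =>
    intro j k hj hk
    rw [SyzRefl.succ_iff hA (cokD P j) (Submodule.mkQ _) (cokD_injective (hj _ (by omega)))
      (Submodule.mkQ_surjective _) (cokD_exact j)]
    exact ih (fun i hi => hj i (by omega)) (by push_cast at hk; omega)

end CokernelsReflexive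

/-! ### Cocycles of an acyclic cone and Ext -/

section Cone

variable {B C : Type u} [Ring B] [AddCommGroup C] [Module B C]
  {Q N : CochainComplex (ModuleCat.{u} B) ℤ} (g : Q ⟶ N)

/-- The map from a term of the mapping cone of `g` to the next module of cycles. -/
def coneToKer (i j k l : ℤ) : (Q.X j × N.X i) →ₗ[B] LinearMap.ker (coneD g j k l) :=
  (coneD g i j k).codRestrict _ (coneD_coneD g i j k l)

lemma coneToKer_exact (i j k l : ℤ) :
    Function.Exact (LinearMap.ker (coneD g i j k)).subtype (coneToKer g i j k l) := by
  intro x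
  rw [Subtype.ext_iff]
  exact ⟨fun h => ⟨⟨x, h⟩, rfl⟩, fun ⟨y, hy⟩ => hy ▸ y.2⟩

variable {g}

lemma coneToKer_surjective (hg : QuasiIso g) {i j k l : ℤ} (hij : i + 1 = j) (hjk : j + 1 = k)
    (hkl : k + 1 = l) : Function.Surjective (coneToKer g i j k l) := by
  rintro ⟨x, hx⟩
  obtain ⟨y, hy⟩ := ((quasiIso_iff_cone_exact g).1 hg i j k l hij hjk hkl x).1 hx
  exact ⟨y, Subtype.ext hy⟩

lemma extVanish_cone (hQ : ∀ n, Module.Projective B (Q.X n)) (hN : ∀ n, ExtVanish B C (N.X n))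
    (i j : ℤ) : ExtVanish B C (Q.X j × N.X i) :=
  ExtVanish.middle (f := LinearMap.inl B (Q.X j) (N.X i)) (g := LinearMap.snd B (Q.X j) (N.X i))
    LinearMap.inl_injective LinearMap.snd_surjective .inl_snd (extVanish_of_projective _) (hN i)


variable (hg : QuasiIso g) (hQ : ∀ n, Module.Projective B (Q.X n))
  (hN : ∀ n, ExtVanish B C (N.X n))

-- Consecutive cocycles form `0 → Z^{m-1} → cone^{m-1} → Z^m → 0` with middle term free of higher
-- Ext. Exactness of `Hom(cone, C)` extends every map `Z^{m-1} → C`, so `Ext¹(Z^m, C) = 0`; as this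
-- holds for all `m`, higher Ext shifts down to degree one.
include hg hQ hN in
lemma extZero_ker_coneD (hhom : ∀ i j k l : ℤ, i + 1 = j → j + 1 = k → k + 1 = l →
      ∀ f : (Q.X k × N.X j) →ₗ[B] C, f ∘ₗ coneD g i j k = 0 →
        ∃ h : (Q.X l × N.X k) →ₗ[B] C, h ∘ₗ coneD g j k l = f) {p : ℕ} :
    ∀ {j k l : ℤ}, j + 1 = k → k + 1 = l →
      ExtZero B C (LinearMap.ker (coneD g j k l)) (p + 1) := by
  induction p with
  | zero =>
    intro j k l hjk hkl
    obtain ⟨i, rfl⟩ : ∃ i, j = i + 1 := ⟨j - 1, by omega⟩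
    obtain ⟨h, rfl⟩ : ∃ h, i = h + 1 := ⟨i - 1, by omega⟩
    refine extZero_one_of_extends (Submodule.injective_subtype _)
      (coneToKer_surjective hg rfl hjk hkl) (coneToKer_exact g _ _ _ _)
      (extVanish_cone hQ hN _ _ 1 one_pos) fun φ => ?_
    obtain ⟨ψ, hψ⟩ := hhom (h - 1) h (h + 1) (h + 1 + 1) (by omega) rfl rfl
      (φ ∘ₗ coneToKer g _ _ _ _) (by
        refine LinearMap.ext fun x => ?_
        have : coneToKer g h (h + 1) (h + 1 + 1) k (coneD g (h - 1) h (h + 1) x) = 0 :=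
          Subtype.ext (coneD_coneD g _ _ _ _ x)
        rw [LinearMap.comp_apply, LinearMap.comp_apply, this, map_zero, LinearMap.zero_apply])
    refine ⟨ψ, ?_⟩
    ext1 x
    obtain ⟨y, rfl⟩ := coneToKer_surjective hg rfl rfl hjk x
    exact LinearMap.congr_fun hψ y
  | succ p ih =>
    intro j k l hjk hkl
    obtain ⟨i, rfl⟩ : ∃ i, j = i + 1 := ⟨j - 1, by omega⟩
    exact extZero_right_of_left (Submodule.injective_subtype _)
      (coneToKer_surjective hg rfl hjk hkl) (coneToKer_exact g _ _ _ _)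
      (extVanish_cone hQ hN _ _ _ (by omega)) (ih rfl hjk)

include hg hQ hN in
lemma extVanish_ker_coneD_pred {i j k l : ℤ} (hij : i + 1 = j) (hjk : j + 1 = k) (hkl : k + 1 = l)
    (h : ExtVanish B C (LinearMap.ker (coneD g j k l))) :
    ExtVanish B C (LinearMap.ker (coneD g i j k)) :=
  ExtVanish.left (Submodule.injective_subtype _)
    (coneToKer_surjective hg hij hjk hkl) (coneToKer_exact g _ _ _ _)
    (extVanish_cone hQ hN _ _) h

-- Conversely, a map vanishing on coboundaries factors through the next cocycles, and extends
-- because the cocycles after those have no `Ext¹`.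
include hg in
lemma exists_extension_cone (h : ∀ j k l : ℤ, j + 1 = k → k + 1 = l →
    ExtVanish B C (LinearMap.ker (coneD g j k l))) {i j k l : ℤ} (hij : i + 1 = j)
    (hjk : j + 1 = k) (hkl : k + 1 = l)
    (f : (Q.X k × N.X j) →ₗ[B] C) (hf : f ∘ₗ coneD g i j k = 0) :
    ∃ h : (Q.X l × N.X k) →ₗ[B] C, h ∘ₗ coneD g j k l = f := by
  obtain ⟨φ, hφ⟩ := exists_factorization (coneToKer g j k l (l + 1))
    (coneToKer_surjective hg hjk hkl rfl) f fun x hx => by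
      obtain ⟨y, rfl⟩ := ((quasiIso_iff_cone_exact g).1 hg i j k l hij hjk hkl x).1
        (congrArg Subtype.val hx)
      exact LinearMap.congr_fun hf y
  obtain ⟨ψ, hψ⟩ := exists_extension_of_extZero_one (Submodule.injective_subtype _)
    (coneToKer_surjective hg hkl rfl rfl) (coneToKer_exact g _ _ _ _)
    (h l (l + 1) (l + 1 + 1) rfl rfl 1 one_pos) φ
  refine ⟨ψ, ?_⟩
  refine LinearMap.ext fun x => ?_
  rw [← hφ, ← hψ]
  rfl

end Cone

/-! ### Biduality in terms of the cokernels of `P` -/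

section ConeDual

variable {A B C : Type u} [Ring A] [Ring B] [AddCommGroup C] [Module A C] [Module B C]
  [SMulCommClass A B C] {P : CochainComplex (ModuleCat.{u} A) ℤ}
  {Q : CochainComplex (ModuleCat.{u} B) ℤ} (g : Q ⟶ dual B C P)

/-- The cocycles of `Hom_A(P, C)` in degree `j`, that is the maps `coker(P^{-j-1} → P^{-j}) → C`,
as cocycles of the mapping cone of `g`. -/
def cokDualToKer {j k l : ℤ} (hjk : j + 1 = k) :
    (Cok P (-j) →ₗ[A] C) →ₗ[B] LinearMap.ker (coneD g j k l) :=
  LinearMap.codRestrict _ (LinearMap.inr B (Q.X k) ((dual B C P).X j) ∘ₗ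
    (dualLin A B C (LinearMap.range (P.d (-j - 1) (-j)).hom).mkQ)) (by
      intro φ
      refine Prod.ext ?_ ?_
      · change -(Q.d k l 0) = 0
        simp
      · change g.f k 0 + (dual B C P).d j k _ = 0
        rw [map_zero, zero_add]
        refine LinearMap.ext fun (x : P.X (-k)) => ?_
        change φ (Submodule.Quotient.mk (P.d (-k) (-j) x)) = 0
        rw [(Submodule.Quotient.mk_eq_zero _).2, map_zero]
        rw [range_d_eq (show -j - 1 = -k by omega)]
        exact ⟨x, rfl⟩)

omit g in
lemma exists_cokDual_eq {j k : ℤ} (hjk : j + 1 = k) (x : P.X (-j) →ₗ[A] C)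
    (hx : (dual B C P).d j k x = 0) :
    ∃ φ : Cok P (-j) →ₗ[A] C, φ ∘ₗ (LinearMap.range (P.d (-j - 1) (-j)).hom).mkQ = x := by
  have hx' : ∀ y, x (P.d (-k) (-j) y) = 0 := fun y =>
    congrArg (fun t : P.X (-k) →ₗ[A] C => t y) hx
  refine ⟨(LinearMap.range (P.d (-j - 1) (-j)).hom).liftQ x ?_, Submodule.liftQ_mkQ _ _ _⟩
  rw [range_d_eq (show -j - 1 = -k by omega)]
  rintro _ ⟨y, rfl⟩
  exact hx' y

lemma cokDualToKer_bijective {j k l : ℤ} (hjk : j + 1 = k) [Subsingleton (Q.X k)] :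
    Function.Bijective (cokDualToKer g (l := l) hjk) := by
  constructor
  · intro φ ψ h
    have : φ ∘ₗ (LinearMap.range (P.d (-j - 1) (-j)).hom).mkQ =
        ψ ∘ₗ (LinearMap.range (P.d (-j - 1) (-j)).hom).mkQ :=
      congrArg Prod.snd (congrArg Subtype.val h)
    exact Submodule.linearMap_qext _ this
  · rintro ⟨⟨q, x⟩, hx⟩
    obtain rfl : q = 0 := Subsingleton.elim _ _
    have h2 : g.f k 0 + (dual B C P).d j k x = 0 := congrArg Prod.snd hx
    rw [map_zero, zero_add] at h2
    obtain ⟨φ, rfl⟩ := exists_cokDual_eq hjk x h2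
    exact ⟨φ, rfl⟩

variable [SMulCommClass B A C] {g} (hg : QuasiIso g) (hQ : IsFGProjComplex Q)
  (hA : Refl A B C A) (hP : IsFGProjComplex P)

omit g in
include hA hP in
lemma extVanish_dual_X (n : ℤ) : ExtVanish B C ((dual B C P).X n) := by
  have := hP.finite (-n)
  have := hP.projective (-n)
  exact (hA.of_projective (P.X (-n))).ext_right

-- Where `Q` is zero, the dual of `Cok P (-j)` is a cocycle module of the cone, so
-- `extZero_ker_coneD` gives its Ext vanishing. Bijectivity of evaluation comes from exactness of
-- `Hom(cone, C)` and evaluation being bijective on the terms of `P`.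
include hg hQ hA hP in
lemma refl_cok_of_quasiIso_dualMap (hd : QuasiIso (dualMap A C g)) {n : ℤ}
    (hext : ∀ j ≤ n, ExtVanish A C (Cok P j)) : ∃ j₀, ∀ j ≤ j₀, Refl A B C (Cok P j) := by
  obtain ⟨M, hM⟩ := hQ.boundedAbove
  have hhom := (quasiIso_dualMap_iff g).1 hd
  have hN := extVanish_dual_X (B := B) hA hP
  have hP' : ∀ j, Refl A B C (P.X j) := fun j => by
    have := hP.finite j
    have := hP.projective j
    exact hA.of_projective (P.X j)
  have hker : ∀ {j k l : ℤ}, j + 1 = k → k + 1 = l →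
      ExtVanish B C (LinearMap.ker (coneD g j k l)) := fun hjk hkl i hi => by
    obtain ⟨p, rfl⟩ := Nat.exists_eq_succ_of_ne_zero hi.ne'
    exact extZero_ker_coneD hg hQ.projective hN hhom hjk hkl
  -- Below `n` the hypothesis `hext` applies; below `-M` the term `Q^{j+1}` is zero.
  refine ⟨min n (-M), fun j' hj' => ?_⟩
  obtain ⟨j, rfl⟩ : ∃ j, j' = -j := ⟨-j', by omega⟩
  have hsub : Subsingleton (Q.X (j + 1)) := hM _ (by omega)
  have hbij := cokDualToKer_bijective g (j := j) (l := j + 1 + 1) rfl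
  let e := LinearEquiv.ofBijective _ hbij
  have := (hP' (-j)).finite
  refine ⟨inferInstance, hext _ (by omega), (hker rfl rfl).of_retract e.toLinearMap
    e.symm.toLinearMap (by ext1; simp), ?_, ?_⟩
  · rw [injective_iff_map_eq_zero]
    intro p hp
    obtain ⟨p, rfl⟩ := Submodule.Quotient.mk_surjective _ p
    have hp' : ∀ φ : Cok P (-j) →ₗ[A] C, φ (Submodule.Quotient.mk p) = 0 := fun φ =>
      LinearMap.congr_fun hp φ
    let ev : (dual B C P).X j →ₗ[B] C := evalMap (A := A) B C (P.X (-j)) p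
    -- As `Q^{j+1} = 0`, the second component of a coboundary is a cocycle of `Hom(P, C)`, hence
    -- comes from a functional on `Cok P (-j)`, which kills `p`. So evaluation at `p` factors
    -- through the next differential of the cone.
    obtain ⟨h, hh⟩ := hhom (j - 1) j (j + 1) (j + 1 + 1) (by omega) rfl rfl
      (ev ∘ₗ LinearMap.snd B _ _) (by
        refine LinearMap.ext fun x => ?_
        obtain ⟨φ, hφ⟩ := exists_cokDual_eq (B := B) (k := j + 1) rfl (coneD g (j - 1) j (j + 1) x).2
          (by
            have h2 : g.f (j + 1) (coneD g (j - 1) j (j + 1) x).1 +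
                (dual B C P).d j (j + 1) (coneD g (j - 1) j (j + 1) x).2 = 0 :=
              congrArg Prod.snd (coneD_coneD g (j - 1) j (j + 1) (j + 1 + 1) x)
            rwa [Subsingleton.elim (coneD g (j - 1) j (j + 1) x).1 0, map_zero, zero_add] at h2)
        let y : P.X (-j) →ₗ[A] C := (coneD g (j - 1) j (j + 1) x).2
        change y p = 0
        rw [show y = _ from hφ.symm]
        exact hp' φ)
    -- On `Hom(P^{-j-1}, C)` the factor `h` is evaluation at some `p'`, and the factorization then
    -- reads `d p' = p`.
    obtain ⟨p', hp''⟩ := (hP' (-(j + 1))).bijective.2 (h ∘ₗ LinearMap.inr B _ _)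
    have hpp : P.d (-(j + 1)) (-j) p' = p := by
      apply (hP' (-j)).bijective.1
      refine LinearMap.ext fun φ => ?_
      have h1 := LinearMap.congr_fun hh (0, φ)
      have h2 := LinearMap.congr_fun hp'' ((dual B C P).d j (j + 1) φ)
      have h3 : coneD g j (j + 1) (j + 1 + 1) (0, φ) = (0, (dual B C P).d j (j + 1) φ) := by
        simp
      rw [LinearMap.comp_apply, h3] at h1
      exact h2.trans h1
    rw [Submodule.Quotient.mk_eq_zero, range_d_eq (show -j - 1 = -(j + 1) by omega)]
    exact ⟨p', hpp⟩
  · intro ξ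
    obtain ⟨η, hη⟩ := exists_extension_of_extZero_one (Submodule.injective_subtype _)
      (coneToKer_surjective hg (i := j) rfl rfl rfl) (coneToKer_exact g _ _ _ _)
      (hker rfl rfl 1 one_pos) (ξ ∘ₗ e.symm.toLinearMap)
    obtain ⟨p, hp⟩ := (hP' (-j)).bijective.2 (η ∘ₗ LinearMap.inr B _ _)
    refine ⟨Submodule.Quotient.mk p, LinearMap.ext fun φ => ?_⟩
    have h1 := LinearMap.congr_fun hη (e φ)
    have h2 := LinearMap.congr_fun hp (φ ∘ₗ Submodule.mkQ _)
    rw [LinearMap.comp_apply, LinearMap.comp_apply, LinearEquiv.coe_coe, e.symm_apply_apply] at h1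
    exact h2.trans h1

-- In large degrees the cocycles of the cone are duals of reflexive cokernels. Their Ext vanishing
-- spreads to all lower degrees along the cocycle sequences, so `exists_extension_cone` applies
-- throughout.
include hg hQ hA hP in
lemma quasiIso_dualMap_of_refl_cok {n : ℤ} (h : ∀ j ≤ n, Refl A B C (Cok P j)) :
    QuasiIso (dualMap A C g) := by
  obtain ⟨M, hM⟩ := hQ.boundedAbove
  have hN := extVanish_dual_X (B := B) hA hP
  have hlarge : ∀ j, max M (-n) ≤ j →
      ExtVanish B C (LinearMap.ker (coneD g j (j + 1) (j + 1 + 1))) := by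
    intro j hj
    have hsub : Subsingleton (Q.X (j + 1)) := hM _ (by omega)
    let e := LinearEquiv.ofBijective _ (cokDualToKer_bijective g (j := j) (l := j + 1 + 1) rfl)
    exact (h (-j) (by omega)).ext_right.of_retract e.symm.toLinearMap e.toLinearMap
      (by ext1; simp)
  have hker : ∀ j, ExtVanish B C (LinearMap.ker (coneD g j (j + 1) (j + 1 + 1))) := by
    intro j
    rcases le_total (max M (-n)) j with hj | hj
    · exact hlarge j hj
    · induction j, hj using Int.leInductionDown with
      | base => exact hlarge _ le_rfl
      | pred j hj ih =>
        have := extVanish_ker_coneD_pred (i := j - 1) hg hQ.projective hN (by omega) rfl rfl ih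
        obtain ⟨i, rfl⟩ : ∃ i, j = i + 1 := ⟨j - 1, by omega⟩
        rw [add_sub_cancel_right] at this ⊢
        exact this
  rw [quasiIso_dualMap_iff]
  intro i j k l hij hjk hkl f hf
  refine exists_extension_cone hg (fun j k l hjk hkl => ?_) hij hjk hkl f hf
  subst hjk hkl
  exact hker j

end ConeDual

/-! ### Existence of finitely generated projective resolutions -/

section ExistsResolution

variable {A : Type u} [Ring A] (N : CochainComplex (ModuleCat.{u} A) ℤ)

/-- The degree `m` part of a resolution of `N` under construction: a finitely generated
projective module, its cocycles, and its map to `Nᵐ`. -/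
structure ResStage (m : ℤ) where
  Q : ModuleCat.{u} A
  finite : Module.Finite A Q
  projective : Module.Projective A Q
  Z : Submodule A Q
  φ : Q →ₗ[A] N.X m

variable {N}

/-- Two consecutive stages of a resolution of `N`, linked by the differential `d`. -/
structure ResStage.Link {m : ℤ} (s : ResStage N m) (t : ResStage N (m + 1))
    (d : s.Q →ₗ[A] t.Q) : Prop where
  mem (x) : d x ∈ t.Z
  ker_eq : s.Z = LinearMap.ker d
  comm (x) : t.φ (d x) = N.d m (m + 1) (s.φ x)
  inj (z) : z ∈ t.Z → (∃ y, N.d m (m + 1) y = t.φ z) → ∃ x, d x = z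
  surj (i) (hi : i + 1 = m) (y) : N.d m (m + 1) y = 0 →
    ∃ x, d x = 0 ∧ ∃ y', N.d i m y' = y - s.φ x

/-- The new term is a free cover of the fibre product of the cocycles `t.Z` and `N.X m` over `N.X (m
+ 1)`. Pairs `(z, y)` bound the cocycles that become coboundaries in `N`; pairs `(0, y)` hit all
cocycles of `N` in degree `m`. -/
lemma ResStage.exists_link [IsNoetherianRing A] {m : ℤ} (hN : Module.Finite A (N.X m))
    (t : ResStage N (m + 1)) : ∃ (s : ResStage N m) (d : s.Q →ₗ[A] t.Q), s.Link t d := by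
  have := t.finite
  let F : Submodule A (t.Q × N.X m) := t.Z.prod ⊤ ⊓
    LinearMap.ker ((-t.φ).coprod (N.d m (m + 1)).hom)
  have hF : ∀ z y, (z, y) ∈ F ↔ z ∈ t.Z ∧ N.d m (m + 1) y = t.φ z := by
    intro z y
    simp only [F, Submodule.mem_inf, Submodule.mem_prod, Submodule.mem_top, and_true,
      LinearMap.mem_ker, LinearMap.coprod_apply, LinearMap.neg_apply]
    exact and_congr_right fun _ => neg_add_eq_zero.trans eq_comm
  obtain ⟨k, p, hp⟩ := Module.Finite.exists_fin' A F
  have hpF : ∀ v, (p v).1.1 ∈ t.Z ∧ N.d m (m + 1) (p v).1.2 = t.φ (p v).1.1 := fun v =>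
    (hF _ _).1 (p v).2
  let d : (Fin k → A) →ₗ[A] t.Q := LinearMap.fst A _ _ ∘ₗ F.subtype ∘ₗ p
  refine ⟨⟨ModuleCat.of A (Fin k → A), inferInstanceAs (Module.Finite A (Fin k → A)),
    inferInstanceAs (Module.Projective A (Fin k → A)), LinearMap.ker d,
    LinearMap.snd A _ _ ∘ₗ F.subtype ∘ₗ p⟩, d, ?_, rfl, ?_, ?_, ?_⟩
  · exact fun x => (hpF x).1
  · exact fun x => (hpF x).2.symm
  · rintro z hz ⟨y, hy⟩
    obtain ⟨v, hv⟩ := hp ⟨(z, y), (hF _ _).2 ⟨hz, hy⟩⟩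
    exact ⟨v, congrArg (fun t => t.1.1) hv⟩
  · intro i _ y hy
    obtain ⟨v, hv⟩ := hp ⟨(0, y), (hF _ _).2 ⟨zero_mem _, by rw [hy, map_zero]⟩⟩
    refine ⟨v, congrArg (fun t => t.1.1) hv, 0, ?_⟩
    have : (p v).1.2 = y := congrArg (fun t => t.1.2) hv
    change _ = y - (p v).1.2
    rw [this, sub_self, map_zero]

variable (N) in
/-- The zero stage. -/
def ResStage.zero (m : ℤ) : ResStage N m :=
  ⟨ModuleCat.of A PUnit, inferInstanceAs (Module.Finite A PUnit.{u + 1}),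
    inferInstanceAs (Module.Projective A PUnit.{u + 1}), ⊤, 0⟩

lemma ResStage.zero_link_zero {m : ℤ} (hN : N.ExactAt m) :
    (ResStage.zero N m).Link (ResStage.zero N (m + 1)) 0 := by
  refine ⟨fun _ => trivial, (LinearMap.ker_zero).symm, ?_, ?_, ?_⟩
  · intro x
    change (0 : _) = N.d m (m + 1) 0
    rw [map_zero]
  · exact fun z _ _ => ⟨0, rfl⟩
  · intro i hi y hy
    obtain ⟨y', hy'⟩ := ((exactAt_iff_exact hi rfl).1 hN y).1 hy
    exact ⟨0, rfl, y', by rw [hy', map_zero, sub_zero]⟩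

variable (N) in
/-- The stages of a resolution of `N` by finitely generated projectives, starting from `0` in the
degrees above `n`. -/
def resStage [IsNoetherianRing A] (hN : ∀ m, Module.Finite A (N.X m)) (n m : ℤ) :
    ResStage N m :=
  if n < m then ResStage.zero N m else
    (ResStage.exists_link (hN m) (resStage hN n (m + 1))).choose
termination_by (n + 1 - m).toNat

lemma exists_resStage_link [IsNoetherianRing A] (hN : ∀ m, Module.Finite A (N.X m)) {n : ℤ}
    (hn : ∀ m, n < m → N.ExactAt m) (m : ℤ) :
    ∃ d, (resStage N hN n m).Link (resStage N hN n (m + 1)) d := by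
  by_cases h : n < m
  · have h₁ : resStage N hN n m = ResStage.zero N m := by rw [resStage, if_pos h]
    have h₂ : resStage N hN n (m + 1) = ResStage.zero N (m + 1) := by
      rw [resStage, if_pos (by omega)]
    rw [h₁, h₂]
    exact ⟨0, ResStage.zero_link_zero (hn m h)⟩
  · rw [resStage.eq_1 N hN n m, if_neg h]
    exact (ResStage.exists_link (hN m) (resStage N hN n (m + 1))).choose_spec

theorem exists_isProjRes [IsNoetherianRing A] (hN : ∀ m, Module.Finite A (N.X m)) {n : ℤ}
    (hn : ∀ m, n < m → N.ExactAt m) :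
    ∃ (Q : CochainComplex (ModuleCat.{u} A) ℤ) (g : Q ⟶ N), IsProjRes g := by
  choose d hd using exists_resStage_link hN hn
  have hdd : ∀ m x, d (m + 1) (d m x) = 0 := fun m x => by
    have := (hd m).mem x
    rw [(hd (m + 1)).ker_eq] at this
    exact this
  let Q : CochainComplex (ModuleCat.{u} A) ℤ :=
    CochainComplex.of (fun m => (resStage N hN n m).Q) (fun m => ModuleCat.ofHom (d m))
      (fun m => by ext x; exact hdd m x)
  have hQd : ∀ m, Q.d m (m + 1) = ModuleCat.ofHom (d m) := fun m =>
    CochainComplex.of_d (fun m => (resStage N hN n m).Q) (fun m => ModuleCat.ofHom (d m)) m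
  let g : Q ⟶ N :=
    { f := fun m => ModuleCat.ofHom (resStage N hN n m).φ
      comm' := by
        rintro i _ rfl
        rw [hQd]
        ext x
        exact ((hd i).comm x).symm }
  refine ⟨Q, g, fun m => (resStage N hN n m).finite, fun m => (resStage N hN n m).projective,
    ⟨n, fun m hm => ?_⟩, ⟨fun j => ?_⟩⟩
  · change Subsingleton (resStage N hN n m).Q
    rw [resStage.eq_1, if_pos hm]
    exact inferInstanceAs (Subsingleton PUnit.{u + 1})
  · obtain ⟨i, rfl⟩ : ∃ i, j = i + 1 := ⟨j - 1, by omega⟩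
    rw [quasiIsoAt_iff_elements g rfl rfl, hQd, hQd]
    -- In degree `i + 1`, injectivity on cohomology comes from the link leaving degree `i`,
    -- surjectivity from the link leaving degree `i + 1`.
    constructor
    · intro x hx hy
      refine (hd i).inj x ?_ hy
      rw [(hd (i + 1)).ker_eq]
      exact hx
    · exact fun y hy => (hd (i + 1)).surj i rfl y hy

end ExistsResolution

/-! ### Independence of the resolution -/

section Independence

variable {A : Type u} [Ring A] {P P' M : CochainComplex (ModuleCat.{u} A) ℤ}

lemma IsFGProjComplex.isKProjective (hP : IsFGProjComplex P) : P.IsKProjective := by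
  obtain ⟨N, hN⟩ := hP.boundedAbove
  have : P.IsStrictlyLE N := by
    rw [CochainComplex.isStrictlyLE_iff]
    intro i hi
    have := hN i hi
    exact ModuleCat.isZero_of_subsingleton _
  have : ∀ n, Projective (P.X n) := fun n => by
    have := hP.projective n
    exact (IsProjective.iff_projective (P.X n)).1 inferInstance
  exact CochainComplex.isKProjective_of_projective P N

/-- Bounded above complexes of projectives are K-projective, so the comparison isomorphisms in the
derived category lift to chain maps. One composite suffices, as only a retract is needed. -/
lemma exists_homotopy_id (hP : IsFGProjComplex P) (hP' : IsFGProjComplex P') (f : P ⟶ M)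
    (f' : P' ⟶ M) [QuasiIso f] [QuasiIso f'] :
    ∃ (φ : P ⟶ P') (ψ : P' ⟶ P), Nonempty (Homotopy (φ ≫ ψ) (𝟙 P)) := by
  let := HasDerivedCategory.standard (ModuleCat.{u} A)
  have := hP.isKProjective
  have := hP'.isKProjective
  let e := DerivedCategory.quotientCompQhIso (ModuleCat.{u} A)
  obtain ⟨a, ha⟩ := (CochainComplex.IsKProjective.Qh_map_bijective P
    ((HomotopyCategory.quotient _ _).obj P')).surjective
    (e.hom.app P ≫ DerivedCategory.Q.map f ≫ inv (DerivedCategory.Q.map f') ≫ e.inv.app P')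
  obtain ⟨b, hb⟩ := (CochainComplex.IsKProjective.Qh_map_bijective P'
    ((HomotopyCategory.quotient _ _).obj P)).surjective
    (e.hom.app P' ≫ DerivedCategory.Q.map f' ≫ inv (DerivedCategory.Q.map f) ≫ e.inv.app P)
  obtain ⟨φ, rfl⟩ := (HomotopyCategory.quotient _ _).map_surjective a
  obtain ⟨ψ, rfl⟩ := (HomotopyCategory.quotient _ _).map_surjective b
  refine ⟨φ, ψ, ⟨HomotopyCategory.homotopyOfEq _ _ ?_⟩⟩
  apply (CochainComplex.IsKProjective.Qh_map_bijective P _).injective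
  rw [Functor.map_comp, Functor.map_comp, ha, hb]
  simp

/-- The map induced by a chain map on the cokernels of the differentials. -/
def cokMap (φ : P ⟶ P') (j : ℤ) : Cok P j →ₗ[A] Cok P' j :=
  Submodule.mapQ _ _ (φ.f j).hom (by
    rintro _ ⟨x, rfl⟩
    exact ⟨φ.f (j - 1) x, d_hom_apply φ _ _ x⟩)

/-- On cokernels the part `d h` of the homotopy vanishes, while `h d` factors through `P^{j+1}`;
subtracting it makes the composite the identity. -/
lemma exists_cok_stable_retract (hP : IsFGProjComplex P) (hP' : IsFGProjComplex P') (f : P ⟶ M)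
    (f' : P' ⟶ M) [QuasiIso f] [QuasiIso f'] (j : ℤ) :
    ∃ (ι : Cok P j →ₗ[A] Cok P' j × P.X (j + 1)) (r : Cok P' j × P.X (j + 1) →ₗ[A] Cok P j),
      r ∘ₗ ι = LinearMap.id := by
  obtain ⟨φ, ψ, ⟨h⟩⟩ := exists_homotopy_id hP hP' f f'
  let dj : Cok P j →ₗ[A] P.X (j + 1) :=
    (LinearMap.range (P.d (j - 1) j).hom).liftQ (P.d j (j + 1)).hom (by
      rintro _ ⟨x, rfl⟩
      exact d_d_apply _ _ _ x)
  refine ⟨(cokMap φ j).prod dj,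
    (cokMap ψ j).coprod (-(Submodule.mkQ _ ∘ₗ (h.hom (j + 1) j).hom)), ?_⟩
  refine Submodule.linearMap_qext _ (LinearMap.ext fun x => ?_)
  have h1 := h.comm j
  rw [dNext_eq h.hom (show (ComplexShape.up ℤ).Rel j (j + 1) by simp),
    prevD_eq h.hom (show (ComplexShape.up ℤ).Rel (j - 1) j by simp)] at h1
  have h2 : ψ.f j (φ.f j x) = h.hom (j + 1) j (P.d j (j + 1) x) +
      P.d (j - 1) j (h.hom j (j - 1) x) + x :=
    congrArg (fun t : P.X j ⟶ P.X j => t x) h1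
  change (Submodule.Quotient.mk (ψ.f j (φ.f j x)) : Cok P j) +
    -(Submodule.Quotient.mk (h.hom (j + 1) j (P.d j (j + 1) x)) : Cok P j) =
      (Submodule.Quotient.mk x : Cok P j)
  have h3 : (Submodule.Quotient.mk (P.d (j - 1) j (h.hom j (j - 1) x)) : Cok P j) = 0 :=
    (Submodule.Quotient.mk_eq_zero _).2 ⟨_, rfl⟩
  rw [h2, Submodule.Quotient.mk_add, Submodule.Quotient.mk_add, h3]
  abel

lemma exactAt_iff_of_quasiIso (f : P ⟶ M) [QuasiIso f] (j : ℤ) : P.ExactAt j ↔ M.ExactAt j := by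
  rw [HomologicalComplex.exactAt_iff_isZero_homology, HomologicalComplex.exactAt_iff_isZero_homology]
  exact (asIso (HomologicalComplex.homologyMap f j)).isZero_iff

end Independence

/-! ### Derived reflexivity and reflexive cokernels -/

section Good

variable {A B C : Type u} [Ring A] [Ring B] [AddCommGroup C] [Module A C] [Module B C]
  [SMulCommClass A B C] {P : CochainComplex (ModuleCat.{u} A) ℤ}

/-- The lower bound comes from `P` being bounded above, and finite generation from `finite_dual`. -/
lemma isBoundedFinite_dual_iff [IsNoetherianRing B] [Module.Finite B C]
    (hP : IsFGProjComplex P) :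
    IsBoundedFinite (dual B C P) ↔ ∃ n, ∀ m, n < m → (dual B C P).ExactAt m := by
  constructor
  · intro h
    obtain ⟨n, hn⟩ := h.bounded.bddAbove
    exact ⟨n, fun m hm => by_contra fun h => absurd (hn h) (not_le.2 hm)⟩
  · rintro ⟨n, hn⟩
    obtain ⟨N, hN⟩ := hP.boundedAbove
    refine ⟨(Set.finite_Icc (-N) n).subset fun m hm => ⟨?_, ?_⟩, fun m => ?_⟩
    · by_contra h
      refine hm ((dual_exactAt_iff (B := B) (C := C) (a := -m - 1) (b := -m) (c := -m + 1)
        (by omega) rfl (by omega)).2 fun φ => ?_)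
      have := hN (-m) (by omega)
      have h0 : φ = 0 := by
        ext x
        rw [Subsingleton.elim x 0, map_zero, map_zero]
      exact ⟨fun _ => ⟨0, by rw [h0, map_zero]⟩, fun _ => by rw [h0, map_zero]⟩
    · by_contra h
      exact hm (hn m (by omega))
    · have := hP.finite (-m)
      have : Module.Finite B ((dual B C P).X m) := finite_dual (P.X (-m))
      have : Module.Finite B ((dual B C P).cycles m) :=
        Module.Finite.of_injective ((dual B C P).iCycles m).hom (iCycles_injective m)
      exact Module.Finite.of_surjective ((dual B C P).homologyπ m).hom (homologyπ_surjective m)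

variable [SMulCommClass B A C]

variable (B C) in
/-- For a complex `P` of projectives: `RHom(P, C)` has bounded finitely generated cohomology, and
the biduality morphism `P → RHom(RHom(P, C), C)` is an isomorphism. -/
def IsDerivedReflexive (P : CochainComplex (ModuleCat.{u} A) ℤ) : Prop :=
  IsBoundedFinite (dual B C P) ∧
    ∃ (Q : CochainComplex (ModuleCat.{u} B) ℤ) (g : Q ⟶ dual B C P),
      IsProjRes g ∧ QuasiIso (bidualMap B C P ≫ dualMap A C g)

lemma isIso_bidualMap_of_projective (hA : Refl A B C A) (hP : IsFGProjComplex P) :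
    IsIso (bidualMap B C P) :=
  isIso_bidualMap fun n => by
    have := hP.finite n
    have := hP.projective n
    exact (hA.of_projective (P.X n)).bijective

/-- Forward: biduality makes the cokernels reflexive far to the left, and Ext vanishing lets
reflexivity climb to `j` (`Refl.cok_ge`). Backward: reflexivity passes to all lower cokernels
(`Refl.cok_le`), which forces biduality. -/
lemma isDerivedReflexive_iff [IsNoetherianRing A] [IsNoetherianRing B] [Module.Finite B C]
    (hA : Refl A B C A) (hP : IsFGProjComplex P) {n j : ℤ} (hj : ∀ i < j, P.ExactAt i)
    (hn : n + j = 0) :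
    (IsDerivedReflexive B C P ∧ ∀ m, n < m → (dual B C P).ExactAt m) ↔
      Refl A B C (Cok P j) := by
  have := isIso_bidualMap_of_projective hA hP
  constructor
  · rintro ⟨⟨-, Q, g, hg, hq⟩, hn'⟩
    -- The terms of `P` are reflexive, so `bidualMap` is an isomorphism of complexes and only the
    -- dual of `g` matters.
    rw [quasiIso_iff_comp_left] at hq
    have hext : ∀ k ≤ j, ExtVanish A C (Cok P k) := fun k hk =>
      (extVanish_cok_iff (B := B) hP (n := -k) (fun i hi => hj i (by omega)) (by omega)).2
        fun m hm => hn' m (by omega)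
    obtain ⟨j₀, hj₀⟩ := refl_cok_of_quasiIso_dualMap hg.quasiIso hg.isFGProjComplex hA hP hq hext
    exact Refl.cok_ge hA hP (min_le_right j₀ j) hj (hext j le_rfl) (hj₀ _ (min_le_left j₀ j))
  · intro h
    have hex := (extVanish_cok_iff (B := B) hP hj hn).1 h.ext_left
    have hfin : ∀ m, Module.Finite B ((dual B C P).X m) := fun m => by
      have := hP.finite (-m)
      exact finite_dual (P.X (-m))
    obtain ⟨Q, g, hg⟩ := exists_isProjRes hfin hex
    have := quasiIso_dualMap_of_refl_cok (A := A) hg.quasiIso hg.isFGProjComplex hA hP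
      fun k hk => Refl.cok_le hA hP hj h hk
    exact ⟨⟨(isBoundedFinite_dual_iff hP).2 ⟨n, hex⟩, Q, g, hg, inferInstance⟩, hex⟩

/-- Exactness in degree `-j` makes every functional on `Cok P j` factor, on `P^j`, through the
differential, so it kills cocycles. As `Cok P j` is reflexive, a cocycle is then zero in it. This
settles dimension zero in `gcDim_eq_syzDim_sub`. -/
lemma exactAt_of_dual_exactAt [IsNoetherianRing A] [IsNoetherianRing B] [Module.Finite B C]
    (hA : Refl A B C A) (hP : IsFGProjComplex P) {j : ℤ} (hj : ∀ i < j, P.ExactAt i)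
    (h : IsDerivedReflexive B C P) (hd : ∀ m, -j ≤ m → (dual B C P).ExactAt m) :
    P.ExactAt j := by
  have hr := (isDerivedReflexive_iff hA hP hj (n := -j) (by omega)).1
    ⟨h, fun m hm => hd m hm.le⟩
  have hd' := (dual_exactAt_iff (B := B) (C := C) (a := j - 1) (b := j) (c := j + 1) (by omega) rfl
    (by omega)).1 (hd (-j) le_rfl)
  refine (exactAt_iff_exact (i := j - 1) (k := j + 1) (by omega) rfl).2 fun x => ⟨fun hx => ?_, ?_⟩
  · have : (Submodule.Quotient.mk x : Cok P j) = 0 := by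
      apply (injective_iff_map_eq_zero _).1 hr.bijective.1
      ext φ
      obtain ⟨ψ, hψ⟩ := (hd' (φ ∘ₗ Submodule.mkQ _)).1 (by
        ext y
        have hy : (Submodule.Quotient.mk (P.d (j - 1) j y) : Cok P j) = 0 :=
          (Submodule.Quotient.mk_eq_zero _).2 ⟨_, rfl⟩
        change φ (Submodule.Quotient.mk (P.d (j - 1) j y)) = 0
        rw [hy, map_zero])
      have h1 : ψ (P.d j (j + 1) x) = φ (Submodule.Quotient.mk x) := LinearMap.congr_fun hψ x
      rw [hx, map_zero] at h1
      exact h1.symm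
    exact (Submodule.Quotient.mk_eq_zero _).1 this
  · rintro ⟨y, rfl⟩
    exact d_d_apply _ _ _ y

end Good

section Dimension

variable (A B C : Type u) [Ring A] [Ring B] [AddCommGroup C] [Module A C] [Module B C]
  [SMulCommClass A B C] [SMulCommClass B A C]

/-- The least `n` such that some `n`-th syzygy of `Z` is `C`-reflexive. -/
def syzDim (Z : Type u) [AddCommGroup Z] [Module A Z] : EReal :=
  ⨅ n ∈ {n : ℕ | SyzRefl A B C n Z}, ((n : ℝ) : EReal)

end Dimension

/-! ### The dimension formula for complexes -/

section Main

variable {R S : Type u} [Ring R] [Ring S] [IsNoetherianRing R]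
  {C : Type u} [AddCommGroup C] [Module R C] [Module Sᵐᵒᵖ C] [SMulCommClass R Sᵐᵒᵖ C]
  [SMulCommClass Sᵐᵒᵖ R C]

lemma gcDimModule_eq_syzDim (hR : Refl R Sᵐᵒᵖ C R) (T : ModuleCat.{u} R) :
    gcDimModule R S C T = syzDim R Sᵐᵒᵖ C T := by
  have : {n : ℕ | HasReflexiveResolution R S C T n} = {n : ℕ | SyzRefl R Sᵐᵒᵖ C n T} :=
    Set.ext fun n => ⟨fun h => h.syzRefl hR, fun h => h.hasReflexiveResolution hR⟩
  rw [gcDimModule, syzDim, this]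

/-- By `isDerivedReflexive_iff` at `j = i - k`, the `k`-th syzygy is reflexive if and only if `M` is
derived reflexive and `RHom(M, C)` has no cohomology above `k - i`. Minimality of `k` forces
cohomology at `k - i`. -/
theorem gcDim_eq_syzDim_sub [IsNoetherianRing Sᵐᵒᵖ] [Module.Finite Sᵐᵒᵖ C] (hR : Refl R Sᵐᵒᵖ C R)
    {P M : CochainComplex (ModuleCat.{u} R) ℤ} {f : P ⟶ M} (hf : IsProjRes f) {i : ℤ}
    (hlt : ∀ j < i, M.ExactAt j) (hi : ¬ M.ExactAt i) :
    gcDim R S C M = syzDim R Sᵐᵒᵖ C (Cok P i) - ((i : ℝ) : EReal) := by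
  have hP := hf.isFGProjComplex
  have := hf.quasiIso
  have hex : ∀ {P' : CochainComplex (ModuleCat.{u} R) ℤ} {f' : P' ⟶ M}, IsProjRes f' →
      ∀ j < i, P'.ExactAt j := fun {P'} {f'} hf' j hj => by
    have := hf'.quasiIso
    exact (exactAt_iff_of_quasiIso f' j).2 (hlt j hj)
  -- `InClassR` and `supRHom` allow any resolution `P'`, so its cokernel must be compared with that
  -- of `P`.
  have hcok : ∀ {P' : CochainComplex (ModuleCat.{u} R) ℤ} {f' : P' ⟶ M}, IsProjRes f' →
      ∀ k, SyzRefl R Sᵐᵒᵖ C k (Cok P' i) ↔ SyzRefl R Sᵐᵒᵖ C k (Cok P i) := by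
    intro P' f' hf' k
    have hP' := hf'.isFGProjComplex
    have := hf'.quasiIso
    have := hP.finite
    have := hP.projective
    have := hP'.finite
    have := hP'.projective
    constructor
    · intro h
      obtain ⟨ι, r, hr⟩ := exists_cok_stable_retract hP hP' f f' i
      exact h.of_stable_retract hR ι r hr
    · intro h
      obtain ⟨ι, r, hr⟩ := exists_cok_stable_retract hP' hP f' f i
      exact h.of_stable_retract hR ι r hr
  have hiff : ∀ {P' : CochainComplex (ModuleCat.{u} R) ℤ} {f' : P' ⟶ M}, IsProjRes f' →
      ∀ k : ℕ, (IsDerivedReflexive Sᵐᵒᵖ C P' ∧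
        ∀ m, (k : ℤ) - i < m → (dual Sᵐᵒᵖ C P').ExactAt m) ↔
          SyzRefl R Sᵐᵒᵖ C k (Cok P i) := by
    intro P' f' hf' k
    rw [isDerivedReflexive_iff hR hf'.isFGProjComplex (j := i - k)
      (fun j hj => hex hf' j (by omega)) (by omega), ← hcok hf',
      syzRefl_cok_iff hR hf'.isFGProjComplex (hex hf') rfl]
  by_cases hk : ∃ k, SyzRefl R Sᵐᵒᵖ C k (Cok P i)
  · classical
    set k := Nat.find hk with hk_def
    have hks : SyzRefl R Sᵐᵒᵖ C k (Cok P i) := Nat.find_spec hk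
    have hdim : syzDim R Sᵐᵒᵖ C (Cok P i) = ((k : ℝ) : EReal) :=
      le_antisymm (iInf₂_le k hks) (le_iInf₂ fun n hn => by
        exact_mod_cast Nat.find_min' hk hn)
    have hg := (hiff hf k).2 hks
    have hclass : InClassR R S C M := ⟨P, f, hf, hg.1⟩
    have hnot : ¬ (dual Sᵐᵒᵖ C P).ExactAt (k - i) := by
      intro h
      have hge : ∀ m, (k : ℤ) - i ≤ m → (dual Sᵐᵒᵖ C P).ExactAt m := fun m hm => by
        rcases hm.eq_or_lt with rfl | hm
        · exact h
        · exact hg.2 m hm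
      -- If `k = 0`, vanishing at `-i` would make `P` exact at `i`; otherwise the `(k-1)`-st syzygy
      -- would already be reflexive.
      rcases Nat.eq_zero_or_pos k with h0 | h0
      · apply hi
        rw [← exactAt_iff_of_quasiIso f]
        exact exactAt_of_dual_exactAt hR hP (hex hf) hg.1 fun m hm => hge m (by omega)
      · exact Nat.find_min hk (m := k - 1) (by omega)
          ((hiff hf (k - 1)).1 ⟨hg.1, fun m hm => hge m (by omega)⟩)
    have hsup : supRHom R S C M = (((k - i : ℤ) : ℝ) : EReal) := by
      refine le_antisymm (iSup₂_le ?_) (le_iSup₂_of_le (k - i : ℤ) ⟨P, f, hf, hnot⟩ le_rfl)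
      rintro m ⟨P', f', hf', hm⟩
      have : m ≤ k - i := by
        by_contra hlt
        exact hm (((hiff hf' k).2 hks).2 m (by omega))
      exact_mod_cast this
    rw [gcDim, if_pos hclass, hsup, hdim, ← EReal.coe_sub]
    push_cast
    rfl
  · have hclass : ¬ InClassR R S C M := by
      rintro ⟨P', f', hf', hg⟩
      have hg' : IsDerivedReflexive Sᵐᵒᵖ C P' := hg
      obtain ⟨n, hn⟩ := (isBoundedFinite_dual_iff hf'.isFGProjComplex).1 hg.1
      -- The index `k` is chosen so that `k - i ≥ n`, beyond which the dual is exact.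
      exact hk ⟨(n + i).toNat, (hiff hf' _).1 ⟨hg', fun m hm => hn m (by omega)⟩⟩
    have hdim : syzDim R Sᵐᵒᵖ C (Cok P i) = ⊤ := by
      rw [syzDim]
      simp only [Set.mem_ofPred_eq, iInf_eq_top]
      exact fun n hn => absurd ⟨n, hn⟩ hk
    rw [gcDim, if_neg hclass, hdim, EReal.top_sub_coe]

end Main

/-! ### Top cohomology against the cokernel -/

section HomologyModule

variable {A B C : Type u} [Ring A] [Ring B] [AddCommGroup C] [Module A C] [Module B C]
  [SMulCommClass A B C] [SMulCommClass B A C] {P : CochainComplex (ModuleCat.{u} A) ℤ}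

/-- Descending induction from degrees where the target is zero: a projective image splits off its
source, so the kernel, which is the previous image, is projective too. -/
lemma projective_range_d (hP : IsFGProjComplex P) {i : ℤ} (hi : ∀ j, i < j → P.ExactAt j) :
    Module.Projective A (LinearMap.range (P.d i (i + 1)).hom) := by
  obtain ⟨N, hN⟩ := hP.boundedAbove
  have hlarge : ∀ j, N ≤ j → Module.Projective A (LinearMap.range (P.d j (j + 1)).hom) := by
    intro j hj
    have := hN (j + 1) (by omega)
    infer_instance
  rcases le_total N i with h | h
  · exact hlarge i h
  · induction i, h using Int.leInductionDown with
    | base => exact hlarge _ le_rfl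
    | pred i h ih =>
      have := ih fun j hj => hi j (by omega)
      have := hP.projective i
      rw [sub_add_cancel]
      have hker : LinearMap.range (P.d (i - 1) i).hom = LinearMap.ker (P.d i (i + 1)).hom :=
        ((exactAt_iff_exact (i := i - 1) (by omega) rfl).1
          (hi i (by omega))).linearMap_ker_eq.symm
      rw [hker]
      obtain ⟨s, hs⟩ := Module.projective_lifting_property (P.d i (i + 1)).hom.rangeRestrict
        LinearMap.id (LinearMap.surjective_rangeRestrict _)
      have hs' : ∀ y, (P.d i (i + 1)).hom (s y) = y := fun y =>
        congrArg Subtype.val (LinearMap.congr_fun hs y)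
      let t : P.X i →ₗ[A] P.X i := LinearMap.id - s ∘ₗ (P.d i (i + 1)).hom.rangeRestrict
      have hmem : ∀ x, t x ∈ LinearMap.ker (P.d i (i + 1)).hom := fun x => by
        rw [LinearMap.mem_ker, LinearMap.sub_apply, map_sub, LinearMap.comp_apply, hs']
        exact sub_self _
      refine Module.Projective.of_split (LinearMap.ker (P.d i (i + 1)).hom).subtype
        (LinearMap.codRestrict _ t hmem) (LinearMap.ext fun x => Subtype.ext ?_)
      have hx : (P.d i (i + 1)).hom.rangeRestrict x = 0 := Subtype.ext x.2
      change x.1 - s ((P.d i (i + 1)).hom.rangeRestrict x) = x.1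
      rw [hx, map_zero, sub_zero]

lemma syzRefl_iff_of_exact (hA : Refl A B C A) {k : ℕ} {X Y Z : Type u} [AddCommGroup X]
    [Module A X] [AddCommGroup Y] [Module A Y] [AddCommGroup Z] [Module A Z] [Module.Finite A Z]
    [Module.Projective A Z] {f : X →ₗ[A] Y} {g : Y →ₗ[A] Z} (hf : Function.Injective f)
    (hg : Function.Surjective g) (hfg : Function.Exact f g) :
    SyzRefl A B C k X ↔ SyzRefl A B C k Y := by
  obtain ⟨l, hl⟩ := Module.projective_lifting_property g LinearMap.id hg
  obtain ⟨e, -, -⟩ := hfg.splitSurjectiveEquiv hf ⟨l, hl⟩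
  constructor
  · exact fun h => (h.prod hA (L := Z)).of_equiv hA e
  · intro h
    refine h.of_stable_retract hA (L := PUnit)
      (LinearMap.inl A _ _ ∘ₗ e.symm.toLinearMap ∘ₗ LinearMap.inl A X Z)
      (LinearMap.fst A X Z ∘ₗ e.toLinearMap ∘ₗ LinearMap.fst A _ _) ?_
    ext x
    simp

/-- The sequence `0 → H^i → Cok P i → im d^i → 0` has projective right-hand term. -/
lemma syzRefl_iff_cok_of_homology (hA : Refl A B C A) (hP : IsFGProjComplex P) {i : ℤ}
    (hi : ∀ j, i < j → P.ExactAt j) {T : ModuleCat.{u} A} (e : P.homology i ≅ T) {k : ℕ} :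
    SyzRefl A B C k T ↔ SyzRefl A B C k (Cok P i) := by
  have := projective_range_d hP hi
  have := hP.finite i
  let q : Cok P i →ₗ[A] LinearMap.range (P.d i (i + 1)).hom :=
    (LinearMap.range (P.d (i - 1) i).hom).liftQ (P.d i (i + 1)).hom.rangeRestrict (by
      rintro _ ⟨x, rfl⟩
      exact Subtype.ext (d_d_apply _ _ _ x))
  have hπ := homologyπ_eq_zero_iff (K := P) (show i - 1 + 1 = i by omega)
  have hmk : ∀ x : P.X i, (Submodule.Quotient.mk x : Cok P i) = 0 ↔ ∃ y, P.d (i - 1) i y = x :=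
    fun x => Submodule.Quotient.mk_eq_zero _
  obtain ⟨κ, hκ⟩ := exists_factorization (P.homologyπ i).hom (homologyπ_surjective i)
    (Submodule.mkQ (LinearMap.range (P.d (i - 1) i).hom) ∘ₗ (P.iCycles i).hom) fun z hz =>
      (hmk _).2 ((hπ z).1 hz)
  have hκ' : ∀ z, κ (P.homologyπ i z) = Submodule.Quotient.mk (P.iCycles i z) := fun z =>
    LinearMap.congr_fun hκ z
  have h1 : SyzRefl A B C k (P.homology i) ↔ SyzRefl A B C k (Cok P i) := by
    refine syzRefl_iff_of_exact hA (f := κ) (g := q) ?_ ?_ ?_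
    · rw [injective_iff_map_eq_zero]
      intro t ht
      obtain ⟨z, rfl⟩ := homologyπ_surjective i t
      rw [hκ', hmk] at ht
      exact (hπ z).2 ht
    · rintro ⟨_, x, rfl⟩
      exact ⟨Submodule.Quotient.mk x, rfl⟩
    · intro t
      obtain ⟨x, rfl⟩ := Submodule.Quotient.mk_surjective _ t
      constructor
      · intro hx
        have hx' : P.d i (i + 1) x = 0 := congrArg Subtype.val hx
        obtain ⟨z, rfl⟩ := exists_iCycles_eq rfl x hx'
        exact ⟨P.homologyπ i z, hκ' z⟩
      · rintro ⟨t, ht⟩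
        obtain ⟨z, rfl⟩ := homologyπ_surjective i t
        rw [hκ'] at ht
        rw [← ht]
        exact Subtype.ext (d_iCycles_apply i (i + 1) z)
  rw [← h1]
  exact ⟨fun h => h.of_equiv hA e.toLinearEquiv, fun h => h.of_equiv hA e.toLinearEquiv.symm⟩

end HomologyModule

/-! ### Modules as complexes -/

section Single

variable {A : Type u} [Ring A]

lemma finite_single_X (T : ModuleCat.{u} A) [Module.Finite A T] (n : ℤ) :
    Module.Finite A (((CochainComplex.singleFunctor (ModuleCat.{u} A) 0).obj T).X n) := by
  by_cases hn : n = 0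
  · subst hn
    exact Module.Finite.equiv
      (HomologicalComplex.singleObjXSelf (ComplexShape.up ℤ) 0 T).toLinearEquiv.symm
  · have := ModuleCat.subsingleton_of_isZero
      (HomologicalComplex.isZero_single_obj_X (ComplexShape.up ℤ) 0 T n hn)
    exact Module.Finite.of_finite (R := A)
      (M := ((HomologicalComplex.single (ModuleCat.{u} A) (ComplexShape.up ℤ) 0).obj T).X n)

lemma single_exactAt (T : ModuleCat.{u} A) {c n : ℤ} (h : n ≠ c) :
    ((CochainComplex.singleFunctor (ModuleCat.{u} A) c).obj T).ExactAt n :=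
  HomologicalComplex.exactAt_single_obj _ _ _ _ h

/-- The cohomology of `T` placed in degree `c`. -/
def singleHomologyIso (T : ModuleCat.{u} A) (c : ℤ) :
    ((CochainComplex.singleFunctor (ModuleCat.{u} A) c).obj T).homology c ≅ T :=
  HomologicalComplex.singleObjHomologySelfIso (ComplexShape.up ℤ) c T

lemma IsoShiftedModule.homology_iso {K : CochainComplex (ModuleCat.{u} A) ℤ}
    {T : ModuleCat.{u} A} {c : ℤ} (h : IsoShiftedModule K T c) (n : ℤ) :
    Nonempty (K.homology n ≅
      ((CochainComplex.singleFunctor (ModuleCat.{u} A) c).obj T).homology n) := by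
  let := HasDerivedCategory.standard (ModuleCat.{u} A)
  obtain ⟨e⟩ := h
  let F := DerivedCategory.homologyFunctorFactors (ModuleCat.{u} A) n
  exact ⟨(F.app K).symm ≪≫ (DerivedCategory.homologyFunctor _ n).mapIso e ≪≫ F.app _⟩

lemma IsoShiftedModule.exactAt {K : CochainComplex (ModuleCat.{u} A) ℤ}
    {T : ModuleCat.{u} A} {c : ℤ} (h : IsoShiftedModule K T c) {n : ℤ} (hn : n ≠ c) :
    K.ExactAt n := by
  obtain ⟨e⟩ := h.homology_iso n
  rw [HomologicalComplex.exactAt_iff_isZero_homology]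
  exact ((HomologicalComplex.exactAt_iff_isZero_homology _ _).1 (single_exactAt T hn)).of_iso e

end Single

/-! ### The operation `ω` -/

section Omega

variable {A : Type u} [Ring A] {P : CochainComplex (ModuleCat.{u} A) ℤ}

lemma stupidTruncXIso_comm {ι ι' : Type*} {c : ComplexShape ι} {c' : ComplexShape ι'}
    (K : HomologicalComplex (ModuleCat.{u} A) c') (e : c.Embedding c') [e.IsRelIff] {i j : ι}
    {i' j' : ι'} (hi : e.f i = i') (hj : e.f j = j') :
    (K.stupidTrunc e).d i' j' ≫ (K.stupidTruncXIso e hj).hom =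
      (K.stupidTruncXIso e hi).hom ≫ K.d i' j' := by
  subst hi hj
  have hX : ∀ i, (K.stupidTruncXIso e (rfl : e.f i = e.f i)).hom =
      ((K.restriction e).extendXIso e rfl).hom := fun i => Category.comp_id _
  have h : ((K.restriction e).extend e).d (e.f i) (e.f j) ≫
      ((K.restriction e).extendXIso e rfl).hom =
        ((K.restriction e).extendXIso e rfl).hom ≫ (K.restriction e).d i j := by
    rw [HomologicalComplex.extend_d_eq _ _ rfl rfl, Category.assoc, Category.assoc,
      Iso.inv_hom_id, Category.comp_id]
  exact (congrArg ((K.stupidTrunc e).d (e.f i) (e.f j) ≫ ·) (hX j)).trans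
    (h.trans (congrArg (· ≫ K.d (e.f i) (e.f j)) (hX i)).symm)

/-- The index of the brutal truncation in the definition of `ωP`. -/
abbrev supIndex (P : CochainComplex (ModuleCat.{u} A) ℤ) : ℤ := sSup {n : ℤ | ¬ P.ExactAt n}

lemma embeddingUpIntLE_f_toNat {p m : ℤ} (h : m ≤ p) :
    (ComplexShape.embeddingUpIntLE p).f (p - m).toNat = m := by
  change p - ((p - m).toNat : ℤ) = m
  omega

/-- The terms of `ωP` in degrees `≤ s(P)`. -/
def omegaXIso (P : CochainComplex (ModuleCat.{u} A) ℤ) {n m : ℤ} (hm : m + 1 = n)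
    (hn : n ≤ supIndex P) : (omegaOp P).X n ≅ P.X m :=
  P.stupidTruncXIso (ComplexShape.embeddingUpIntLE (supIndex P - 1)) (i' := n + -1)
    (embeddingUpIntLE_f_toNat (by omega)) ≪≫ P.XIsoOfEq (by omega)

/-- The sign is that of the shift `[-1]`; it leaves kernels and images unchanged. -/
lemma omegaXIso_comm {n m n' m' : ℤ} (hm : m + 1 = n) (hn : n ≤ supIndex P) (hm' : m' + 1 = n')
    (hn' : n' ≤ supIndex P) (x : (omegaOp P).X n) :
    (omegaXIso P hm' hn').hom ((omegaOp P).d n n' x) =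
      -(P.d m m' ((omegaXIso P hm hn).hom x)) := by
  have h1 : (omegaOp P).d n n' = -(P.stupidTrunc
      (ComplexShape.embeddingUpIntLE (supIndex P - 1))).d (n + -1) (n' + -1) := by
    change (-1 : ℤ).negOnePow • _ = _
    rw [Int.negOnePow_neg, Int.negOnePow_one]
    exact (Units.neg_smul 1 _).trans (congrArg Neg.neg (one_smul _ _))
  have h3 : (-(P.stupidTrunc (ComplexShape.embeddingUpIntLE (supIndex P - 1))).d
      (n + -1) (n' + -1)) ≫ (P.stupidTruncXIso
        (ComplexShape.embeddingUpIntLE (supIndex P - 1)) (i' := n' + -1)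
        (embeddingUpIntLE_f_toNat (by omega)) ≪≫ P.XIsoOfEq (show n' + -1 = m' by omega)).hom =
      -((P.stupidTruncXIso (ComplexShape.embeddingUpIntLE (supIndex P - 1)) (i' := n + -1)
        (embeddingUpIntLE_f_toNat (by omega)) ≪≫
          P.XIsoOfEq (show n + -1 = m by omega)).hom ≫ P.d m m') := by
    rw [Preadditive.neg_comp, Iso.trans_hom, Iso.trans_hom, ← Category.assoc,
      stupidTruncXIso_comm _ _ (embeddingUpIntLE_f_toNat (by omega))]
    simp
  have h2 : (omegaOp P).d n n' ≫ (omegaXIso P hm' hn').hom =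
      -((omegaXIso P hm hn).hom ≫ P.d m m') := by
    rw [h1]
    exact h3
  exact congrArg (fun t : (omegaOp P).X n ⟶ P.X m' => t x) h2

lemma subsingleton_omegaOp_X {n : ℤ} (hn : supIndex P < n) : Subsingleton ((omegaOp P).X n) :=
  ModuleCat.subsingleton_of_isZero (P.isZero_stupidTrunc_X
    (ComplexShape.embeddingUpIntLE (supIndex P - 1)) (n + -1)
    ((ComplexShape.notMem_range_embeddingUpIntLE_iff _ _).2 (by omega)))

lemma IsFGProjComplex.omegaOp (hP : IsFGProjComplex P) : IsFGProjComplex (omegaOp P) := by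
  refine ⟨fun n => ?_, fun n => ?_, supIndex P, fun n hn => subsingleton_omegaOp_X hn⟩
  · rcases lt_or_ge (supIndex P) n with h | h
    · have := subsingleton_omegaOp_X h
      infer_instance
    · have := hP.finite (n - 1)
      exact Module.Finite.equiv (omegaXIso P (sub_add_cancel n 1) h).toLinearEquiv.symm
  · rcases lt_or_ge (supIndex P) n with h | h
    · have := subsingleton_omegaOp_X h
      infer_instance
    · have := hP.projective (n - 1)
      exact Module.Projective.of_equiv (omegaXIso P (sub_add_cancel n 1) h).toLinearEquiv.symm

lemma omegaOp_exactAt {j k : ℤ} (hk : k + 1 = j) (hj : j + 1 ≤ supIndex P)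
    (h : P.ExactAt k) : (omegaOp P).ExactAt j := by
  subst hk
  rw [exactAt_iff_exact (i := k) (k := k + 1 + 1) rfl rfl]
  rw [exactAt_iff_exact (i := k - 1) (k := k + 1) (by omega) rfl] at h
  intro x
  constructor
  · intro hx
    have h1 := omegaXIso_comm (P := P) (n := k + 1) rfl (by omega) (m' := k + 1) rfl hj x
    rw [hx, map_zero, eq_comm, neg_eq_zero] at h1
    obtain ⟨y, hy⟩ := (h _).1 h1
    let e := omegaXIso P (n := k) (m := k - 1) (by omega) (by omega)
    refine ⟨-(e.inv y), ?_⟩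
    apply (omegaXIso P (n := k + 1) (m := k) rfl (by omega)).toLinearEquiv.injective
    have h2 := omegaXIso_comm (P := P) (n := k) (m := k - 1) (by omega) (by omega) (m' := k) rfl
      (by omega) (-(e.inv y))
    have h3 : e.hom (-(e.inv y)) = -y :=
      (map_neg e.hom.hom _).trans (congrArg Neg.neg (e.toLinearEquiv.apply_symm_apply y))
    rw [h3, map_neg (P.d (k - 1) k).hom, neg_neg, hy] at h2
    exact h2
  · rintro ⟨y, rfl⟩
    exact d_d_apply _ _ _ _

/-- The case `j + 1 = s(P)` is allowed: the next term of `ωP` is then zero, so exactness of `ωP`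
says more than exactness of `P`. -/
lemma exactAt_of_omegaOp_exactAt {j : ℤ} (hj : j + 1 ≤ supIndex P)
    (h : (omegaOp P).ExactAt (j + 1)) : P.ExactAt j := by
  rw [exactAt_iff_exact (i := j) (k := j + 1 + 1) rfl rfl] at h
  rw [exactAt_iff_exact (i := j - 1) (k := j + 1) (by omega) rfl]
  intro x
  constructor
  · intro hx
    let e := omegaXIso P (n := j + 1) (m := j) rfl hj
    have h3 : e.hom (e.inv x) = x := e.toLinearEquiv.apply_symm_apply x
    obtain ⟨y, hy⟩ := (h (e.inv x)).1 (by
      rcases lt_or_ge (supIndex P) (j + 1 + 1) with h | h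
      · have := subsingleton_omegaOp_X h
        exact Subsingleton.elim _ _
      · apply (omegaXIso P (n := j + 1 + 1) (m := j + 1) rfl h).toLinearEquiv.injective
        have h2 := omegaXIso_comm (P := P) (n := j + 1) rfl hj (m' := j + 1) rfl h (e.inv x)
        rw [h3, hx, neg_zero] at h2
        rw [map_zero]
        exact h2)
    have h2 := omegaXIso_comm (P := P) (n := j) (m := j - 1) (by omega) (by omega) (m' := j) rfl
      hj y
    rw [hy, h3, ← map_neg] at h2
    exact ⟨_, h2.symm⟩
  · rintro ⟨y, rfl⟩
    exact d_d_apply _ _ _ _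

lemma nonempty_cok_omegaOp_equiv {j : ℤ} (hj : j + 1 ≤ supIndex P) :
    Nonempty (Cok (omegaOp P) (j + 1) ≃ₗ[A] Cok P j) := by
  refine ⟨Submodule.Quotient.equiv _ _
    (omegaXIso P (n := j + 1) (m := j) rfl hj).toLinearEquiv ?_⟩
  rw [range_d_eq (P := omegaOp P) (show j + 1 - 1 = j by omega)]
  have h := omegaXIso_comm (P := P) (n := j) (m := j - 1) (by omega) (by omega) (m' := j) rfl hj
  let e := omegaXIso P (n := j) (m := j - 1) (by omega) (by omega)
  ext x
  constructor
  · rintro ⟨_, ⟨y, rfl⟩, rfl⟩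
    exact ⟨-(e.hom y), (map_neg _ _).trans (h y).symm⟩
  · rintro ⟨y, rfl⟩
    refine ⟨_, ⟨-(e.inv y), rfl⟩, (h _).trans ?_⟩
    have h3 : e.hom (e.inv y) = y := e.toLinearEquiv.apply_symm_apply y
    rw [map_neg e.hom.hom, h3, map_neg, neg_neg]

lemma cohSup_eq {K : CochainComplex (ModuleCat.{u} A) ℤ} {j : ℤ}
    (h : ∀ k, j < k → K.ExactAt k) (hj : ¬ K.ExactAt j) : cohSup K = ((j : ℝ) : EReal) := by
  refine le_antisymm (iSup₂_le fun n hn => ?_)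
    (le_iSup₂_of_le (f := fun (n : ℤ) _ => ((n : ℝ) : EReal)) j hj le_rfl)
  have : n ≤ j := by
    by_contra hlt
    exact hn (h n (by omega))
  exact_mod_cast this

lemma cohInf_eq {K : CochainComplex (ModuleCat.{u} A) ℤ} {j : ℤ}
    (h : ∀ k < j, K.ExactAt k) (hj : ¬ K.ExactAt j) : cohInf K = ((j : ℝ) : EReal) := by
  refine le_antisymm (iInf₂_le (f := fun (n : ℤ) _ => ((n : ℝ) : EReal)) j hj)
    (le_iInf₂ fun n hn => ?_)
  have : j ≤ n := by
    by_contra hlt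
    exact hn (h n (by omega))
  exact_mod_cast this

lemma lt_supIndex_of_amplitude_ne_zero (hP : IsFGProjComplex P) {j : ℤ}
    (hlt : ∀ k < j, P.ExactAt k) (hj : ¬ P.ExactAt j) (ha : amplitude P ≠ 0) :
    j + 1 ≤ supIndex P := by
  obtain ⟨N, hN⟩ := hP.boundedAbove
  -- Without an upper bound `sSup` takes a default value unrelated to the cohomology.
  have hbdd : BddAbove {n : ℤ | ¬ P.ExactAt n} := by
    refine ⟨N, fun n hn => ?_⟩
    by_contra h
    have := hN n (by omega)
    exact hn (HomologicalComplex.ExactAt.of_isZero (ModuleCat.isZero_of_subsingleton _))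
  have hle : ∀ n, ¬ P.ExactAt n → n ≤ supIndex P := fun n hn => le_csSup hbdd hn
  by_contra h
  apply ha
  have hgt : ∀ k, j < k → P.ExactAt k := fun k hk => by
    by_contra hk'
    have := hle k hk'
    omega
  rw [amplitude, cohSup_eq hgt hj, cohInf_eq hlt hj, ← EReal.coe_sub, sub_self, EReal.coe_zero]

/-- Nonzero amplitude puts the top cohomology strictly above the lowest, so the truncation leaves
the lowest cokernel untouched and cannot destroy the nonvanishing cohomology there. -/
lemma omegaOp_iterate {b : ℕ} (hP : IsFGProjComplex P) {i : ℤ} (hlt : ∀ k < i, P.ExactAt k)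
    (hi : ¬ P.ExactAt i) (hb : ∀ k < b, amplitude (omegaOp^[k] P) ≠ 0) :
    IsFGProjComplex (omegaOp^[b] P) ∧ (∀ k < i + b, (omegaOp^[b] P).ExactAt k) ∧
      ¬ (omegaOp^[b] P).ExactAt (i + b) ∧
      Nonempty (Cok (omegaOp^[b] P) (i + b) ≃ₗ[A] Cok P i) := by
  induction b with
  | zero =>
    rw [Function.iterate_zero_apply, Nat.cast_zero, add_zero]
    exact ⟨hP, hlt, hi, ⟨LinearEquiv.refl _ _⟩⟩
  | succ b ih =>
    obtain ⟨h1, h2, h3, ⟨e⟩⟩ := ih fun k hk => hb k (by omega)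
    have hs := lt_supIndex_of_amplitude_ne_zero h1 h2 h3 (hb b (by omega))
    rw [Function.iterate_succ_apply', Nat.cast_succ, ← add_assoc]
    refine ⟨h1.omegaOp, fun k hk => omegaOp_exactAt (k := k - 1) (by omega) (by omega)
      (h2 _ (by omega)), fun h => h3 (exactAt_of_omegaOp_exactAt hs h), ?_⟩
    obtain ⟨e'⟩ := nonempty_cok_omegaOp_equiv hs
    exact ⟨e'.trans e⟩

end Omega

lemma IsBoundedFinite.exists_least {A : Type u} [Ring A] {K : CochainComplex (ModuleCat.{u} A) ℤ}
    (hK : IsBoundedFinite K) (h0 : ∃ n, ¬ K.ExactAt n) :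
    ∃ i, (∀ k < i, K.ExactAt k) ∧ ¬ K.ExactAt i := by
  obtain ⟨i, hi, hmin⟩ := Set.exists_min_image _ id hK.bounded h0
  exact ⟨i, fun k hk => by_contra fun h => absurd (hmin k h) (not_le.2 hk), hi⟩

lemma syzDim_congr {A B C : Type u} [Ring A] [Ring B] [AddCommGroup C] [Module A C] [Module B C]
    [SMulCommClass A B C] [SMulCommClass B A C] {X Y : Type u} [AddCommGroup X] [Module A X]
    [AddCommGroup Y] [Module A Y] (h : ∀ n, SyzRefl A B C n X ↔ SyzRefl A B C n Y) :
    syzDim A B C X = syzDim A B C Y := by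
  have : {n : ℕ | SyzRefl A B C n X} = {n : ℕ | SyzRefl A B C n Y} := Set.ext h
  rw [syzDim, syzDim, this]

lemma eq_top_of_sub_coe_eq_top {x : EReal} {r : ℝ} (h : x - (r : EReal) = ⊤) : x = ⊤ := by
  induction x with
  | bot => simp [EReal.bot_sub] at h
  | coe a => exact absurd h (by rw [← EReal.coe_sub]; exact EReal.coe_ne_top _)
  | top => rfl

end GCDim

end

/-! ### The theorem -/

theorem theorem3p4 {R S : Type u} [Ring R] [Ring S] [IsNoetherianRing R] [IsNoetherianRing Sᵐᵒᵖ]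
    {C : Type u} [AddCommGroup C] [Module R C] [Module Sᵐᵒᵖ C] [SMulCommClass R Sᵐᵒᵖ C]
    (hC : GCDim.IsSemidualizing R S C)
    (M : CochainComplex (ModuleCat.{u} R) ℤ) (hM : GCDim.IsBoundedFinite M)
    (hM0 : ∃ n : ℤ, ¬ M.ExactAt n)
    (T : ModuleCat.{u} R) (hT : GCDim.IsTrunk M T) :
    GCDim.gcDim R S C M = GCDim.gcDimModule R S C T - GCDim.cohInf M ∧
    GCDim.gcDim R S C M =
      GCDim.gcDim R S C ((CochainComplex.singleFunctor (ModuleCat.{u} R) 0).obj T) -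
        GCDim.cohInf M ∧
    (GCDim.gcDim R S C M = ⊤ ↔ GCDim.gcDimModule R S C T = ⊤) := by
  have := SMulCommClass.symm R Sᵐᵒᵖ C
  have := hC.finite_right
  have hR := hC.refl_self
  obtain ⟨i, hlt, hi⟩ := hM.exists_least hM0
  obtain ⟨hTfin, P, f, b, c, hf, ⟨hb, hbmin⟩, hiso⟩ := hT
  have hP := hf.toIsProjRes.isFGProjComplex
  have := hf.quasiIso
  obtain ⟨hQ, -, hne, ⟨e⟩⟩ := GCDim.omegaOp_iterate (b := b) hP
    (fun k hk => (GCDim.exactAt_iff_of_quasiIso f k).2 (hlt k hk))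
    (fun h => hi ((GCDim.exactAt_iff_of_quasiIso f i).1 h))
    fun k hk h => absurd (hbmin h) (not_le.2 hk)
  -- `ωᵇP` has cohomology in degree `i + b`, whereas `T[-c]` can have it only in degree `c`.
  obtain rfl : i + b = c := by
    by_contra h
    exact hne (hiso.exactAt h)
  obtain ⟨e'⟩ := hiso.homology_iso (i + b)
  have hM' : GCDim.gcDim R S C M = GCDim.syzDim R Sᵐᵒᵖ C T - ((i : ℝ) : EReal) := by
    rw [GCDim.gcDim_eq_syzDim_sub hR hf.toIsProjRes hlt hi]
    congr 1
    refine GCDim.syzDim_congr fun n => ?_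
    rw [GCDim.syzRefl_iff_cok_of_homology hR hQ (fun j hj => hiso.exactAt hj.ne')
      (e' ≪≫ GCDim.singleHomologyIso T _)]
    exact ⟨fun h => h.of_equiv hR e, fun h => h.of_equiv hR e.symm⟩
  obtain ⟨P', f', hf'⟩ := GCDim.exists_isProjRes (n := 0) (GCDim.finite_single_X T)
    fun m hm => GCDim.single_exactAt T hm.ne'
  have hT0 : ¬ ((CochainComplex.singleFunctor (ModuleCat.{u} R) 0).obj T).ExactAt 0 := by
    intro h
    apply hne
    rw [HomologicalComplex.exactAt_iff_isZero_homology] at h ⊢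
    exact h.of_iso (e' ≪≫ GCDim.singleHomologyIso T _ ≪≫ (GCDim.singleHomologyIso T 0).symm)
  -- The dimension formula applies to `T` in degree `0`, with `i = 0`; nonvanishing of `T` was
  -- needed for this.
  have hT' : GCDim.gcDim R S C ((CochainComplex.singleFunctor (ModuleCat.{u} R) 0).obj T) =
      GCDim.syzDim R Sᵐᵒᵖ C T := by
    have := hf'.quasiIso
    rw [GCDim.gcDim_eq_syzDim_sub hR hf' (fun j hj => GCDim.single_exactAt T hj.ne) hT0,
      Int.cast_zero, EReal.coe_zero, sub_zero]
    refine (GCDim.syzDim_congr fun n => GCDim.syzRefl_iff_cok_of_homology hR hf'.isFGProjComplex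
      (fun j hj => (GCDim.exactAt_iff_of_quasiIso f' j).2 (GCDim.single_exactAt T hj.ne'))
      (asIso (HomologicalComplex.homologyMap f' 0) ≪≫ GCDim.singleHomologyIso T 0)).symm
  have hinf := GCDim.cohInf_eq hlt hi
  rw [GCDim.gcDimModule_eq_syzDim hR, hT', hinf, hM']
  refine ⟨rfl, rfl, fun h => ?_, fun h => by rw [h, EReal.top_sub_coe]⟩
  exact GCDim.eq_top_of_sub_coe_eq_top h
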